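/- For $\phi:\mathbb R^2\to\mathbb R$ let $H(\phi)(y)$ denote its $2\times2$ Hessian matrix at $y$, and let $\sigma$ be the projection measure on the surface $\{(y,|y|^2+\phi(y)):y\in\mathbb R^2\}\subset\mathbb R^3$, i.e. $\int g\,d\sigma=\int_{\mathbb R^2} g(y,|y|^2+\phi(y))\,dy$. For complex-valued $f\in L^2(\mathbb R^2)$ let $\|f\sigma\ast f\sigma\|_{L^2(\mathbb R^3)}$ be the $L^2$ norm of the density of the convolution measure $f\sigma\ast f\sigma$ with respect to Lebesgue measure ($\infty$ if there is no density), and put $$\mathcal R_\phi=\sup_{0\ne f\in L^2(\mathbb R^2)}\frac{\|f\sigma\ast f\sigma\|_{L^2(\mathbb R^3)}^{1/2}}{\|f\|_{L^2(\mathbb R^2)}}.$$ An extremizing sequence for the inequality $$\|f\sigma\ast f\sigma\|_{L^2(\mathbb R^3)}\le\mathcal R_\phi^2\,\|f\|_{L^2(\mathbb R^2)}^2\qquad(\ast)$$ is a sequence $\{f_n\}\subset L^2(\mathbb R^2)$ with $\|f_n\|_{L^2}\le1$ for all $n$ and $\|f_n\sigma\ast f_n\sigma\|_{L^2(\mathbb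 R^3)}\to\mathcal R_\phi^2$ as $n\to\infty$. A sequence $\{f_n\}\subset L^2(\mathbb R^2)$ concentrates at infinity if for all $\varepsilon,\rho>0$ there is $N$ such that $\int_{\{|y|\le\rho\}}|f_n(y)|^2\,dy\le\varepsilon\|f_n\|_{L^2}^2$ for every $n\ge N$. **Corollary 5.5.** Let $\phi:\mathbb R^2\to\mathbb R$ be a nonnegative, twice continuously differentiable, strictly convex function such that (i) $H(\phi)(y)\neq0$ (the zero matrix) for every $y\in\mathbb R^2$, and (ii) there exists a sequence $\{y_n\}\subset\mathbb R^2$ with $|y_n|\to\infty$ such that $H(\phi)(y_n)\to0$ as $n\to\infty$. Then every extremizing sequence for $(\ast)$ concentrates at infinity. -/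

import Mathlib

open MeasureTheory Filter Topology

/-- The Euclidean plane `ℝ²`. -/
abbrev Plane : Type := EuclideanSpace ℝ (Fin 2)

/-- The Hessian matrix `H(φ)(y)` of second order partial derivatives. -/
noncomputable def hessian (φ : Plane → ℝ) (y : Plane) : Matrix (Fin 2) (Fin 2) ℝ :=
  Matrix.of fun i j =>
    fderiv ℝ (fderiv ℝ φ) y (EuclideanSpace.single i 1) (EuclideanSpace.single j 1)

/-- The projection measure `σ` on `Σ_φ = {(y, |y|² + φ(y)) : y ∈ ℝ²} ⊆ ℝ² × ℝ`: the image of Lebesgue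
measure under `y ↦ (y, |y|² + φ(y))`, so that `∫ g dσ = ∫ g(y, |y|² + φ(y)) dy`. -/
noncomputable def projMeasure (φ : Plane → ℝ) : Measure (Plane × ℝ) :=
  (volume : Measure Plane).map fun y => (y, ‖y‖ ^ 2 + φ y)

/-- `F` is the Radon–Nikodym density, with respect to Lebesgue measure on `ℝ² × ℝ = ℝ³`, of the
(complex, locally finite) convolution measure `fσ ∗ fσ`, i.e. `∫ g F = ∫∫ g(p + q) d(fσ)(p) d(fσ)(q)`
for every continuous compactly supported `g`. For `φ ≥ 0` and `f ∈ L²` the last integral is over a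
bounded set of pairs `(p, q) ∈ Σ_φ × Σ_φ`, and converges absolutely. -/
def IsConvDensity (φ : Plane → ℝ) (f : Plane → ℂ) (F : Plane × ℝ → ℂ) : Prop :=
  LocallyIntegrable F volume ∧
    ∀ g : Plane × ℝ → ℝ, Continuous g → HasCompactSupport g →
      ∫ x, g x • F x =
        ∫ pq : (Plane × ℝ) × (Plane × ℝ), g (pq.1 + pq.2) • (f pq.1.1 * f pq.2.1)
          ∂((projMeasure φ).prod (projMeasure φ))

/-- The norm `‖fσ ∗ fσ‖` in `L²(ℝ³)`: the `L²` norm of the density of `fσ ∗ fσ`, which is unique almost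
everywhere if it exists, and `∞` if `fσ ∗ fσ` has no density. -/
noncomputable def convNorm (φ : Plane → ℝ) (f : Plane → ℂ) : ENNReal :=
  ⨅ (F : Plane × ℝ → ℂ) (_ : IsConvDensity φ f F), eLpNorm F 2 volume

/-- The density of `fσ ∗ fσ` is unique almost everywhere, so `convNorm` is its `L²` norm. -/
theorem IsConvDensity.convNorm_eq {φ : Plane → ℝ} {f : Plane → ℂ} {F : Plane × ℝ → ℂ}
    (hF : IsConvDensity φ f F) : convNorm φ f = eLpNorm F 2 volume := by
  apply le_antisymm
  · exact iInf₂_le F hF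
  · refine le_iInf₂ fun G hG => le_of_eq (eLpNorm_congr_ae ?_)
    refine ae_eq_of_integral_contDiff_smul_eq hF.1 hG.1 fun g hg hgc => ?_
    rw [hF.2 g hg.continuous hgc, hG.2 g hg.continuous hgc]

/-- The optimal constant
`R_φ = sup {‖fσ ∗ fσ‖_{L²(ℝ³)}^{1/2} / ‖f‖_{L²(ℝ²)} : 0 ≠ f ∈ L²(ℝ²)}`, in `[0, ∞]`. -/
noncomputable def optimalConstant (φ : Plane → ℝ) : ENNReal :=
  ⨆ (f : Lp ℂ 2 (volume : Measure Plane)) (_ : f ≠ 0),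
    convNorm φ f ^ (1 / 2 : ℝ) / ENNReal.ofReal ‖f‖

/-- `(f_n)` is an extremizing sequence for `‖fσ ∗ fσ‖_{L²(ℝ³)} ≤ R_φ² ‖f‖_{L²(ℝ²)}²`. -/
def IsExtremizingSeq (φ : Plane → ℝ) (f : ℕ → Lp ℂ 2 (volume : Measure Plane)) : Prop :=
  (∀ n, ‖f n‖ ≤ 1) ∧
    Tendsto (fun n => convNorm φ (f n)) atTop (𝓝 (optimalConstant φ ^ 2))

/-- `(f_n)` concentrates at infinity. -/
def ConcentratesAtInfinity (f : ℕ → Lp ℂ 2 (volume : Measure Plane)) : Prop :=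
  ∀ ε : ℝ, 0 < ε → ∀ ρ : ℝ, 0 < ρ → ∃ N : ℕ, ∀ n : ℕ, N ≤ n →
    ∫ y in {y : Plane | ‖y‖ ≤ ρ}, ‖f n y‖ ^ 2 ≤ ε * ‖f n‖ ^ 2

/-! Write a pair of points as midpoint `x` plus or minus half-difference `w`. For fixed `x`, the
density of `σ ∗ σ` is the density of the law of `w ↦ pairPhase φ x w`. In polar coordinates it is
the integral over directions `e` of `r / (4 r + gradGap φ x e r)`, where `gradGap ≥ 0` by convexity.
Hence the density is at most `2π / 4 = π / 2`.

Two facts about `φ` sharpen this. A nonzero Hessian makes `gradGap` at least a multiple of `r` on a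
sector of directions; by compactness the density is then at most `π / 2 - δ` on bounded sets
(`exists_lintegral_pairPhase_le`). Weighted Cauchy–Schwarz (`lintegral_density_le`) yields `‖fσ ∗
fσ‖² + δ m² ≤ (π / 2) ‖f‖⁴`, with `m` the mass of `|f|²` in the ball of radius `ρ`
(`exists_convNorm_sq_add_le`).

Conversely, near a point with small Hessian the density is almost `π / 2`. Exponentials of the
height above the tangent plane almost saturate Cauchy–Schwarz there, so `R_φ⁴ ≥ π / 2`
(`pi_div_two_le_optimalConstant`). An extremizing sequence therefore cannot keep a fixed fraction of
its mass in a ball: the loss `δ m²` would hold it below `π / 2`. -/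

/-! ### Polar coordinates and radial change of variables -/

/-- The unit vector of angle `θ` in the plane. -/
noncomputable def unitVec (θ : ℝ) : Plane := !₂[Real.cos θ, Real.sin θ]

theorem norm_unitVec (θ : ℝ) : ‖unitVec θ‖ = 1 := by
  simp [unitVec, EuclideanSpace.norm_eq]

theorem continuous_unitVec : Continuous unitVec := by
  unfold unitVec
  refine (PiLp.continuous_toLp 2 _).comp (continuous_pi fun i => ?_)
  fin_cases i
  · exact Real.continuous_cos
  · exact Real.continuous_sin

theorem unitVec_zero : unitVec 0 = EuclideanSpace.single 0 1 := by
  ext i; fin_cases i <;> simp [unitVec]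

theorem unitVec_pi_div_two : unitVec (Real.pi / 2) = EuclideanSpace.single 1 1 := by
  ext i; fin_cases i <;> simp [unitVec]

/-- Integration over the plane in polar coordinates. -/
theorem lintegral_plane_polar {G : Plane → ENNReal} (hG : Measurable G) :
    ∫⁻ w, G w = ∫⁻ θ in Set.Ioo (-Real.pi) Real.pi, ∫⁻ r in Set.Ioi (0 : ℝ),
      ENNReal.ofReal r * G (r • unitVec θ) := by
  have h1 : ∫⁻ w, G w = ∫⁻ p : ℝ × ℝ, G (!₂[p.1, p.2]) := by
    rw [← (PiLp.volume_preserving_toLp (Fin 2)).lintegral_comp hG]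
    exact ((volume_preserving_finTwoArrow ℝ).symm.lintegral_comp
      (hG.comp (PiLp.volume_preserving_toLp (Fin 2)).measurable)).symm
  have hm : Measurable fun p : ℝ × ℝ => ENNReal.ofReal p.1 * G (p.1 • unitVec p.2) := by
    refine (ENNReal.measurable_ofReal.comp measurable_fst).mul (hG.comp ?_)
    exact (continuous_fst.smul (continuous_unitVec.comp continuous_snd)).measurable
  rw [h1, ← lintegral_comp_polarCoord_symm, polarCoord_target, Measure.volume_eq_prod,
    ← Measure.prod_restrict]
  rw [← lintegral_prod_symm' _ hm]
  refine lintegral_congr fun p => ?_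
  rw [smul_eq_mul]
  congr 2
  ext i; fin_cases i <;> simp [unitVec]

/-- One-dimensional change of variables, upper bound: `dr` against a derivative that dominates. -/
theorem lintegral_radial_le {η η' : ℝ → ℝ} {k : ℝ} (hk : 0 < k) {p : ℝ → ENNReal}
    (hη : ∀ r, HasDerivAt η (η' r) r) (hpos : ∀ r, 0 < r → 0 < η' r)
    (hb : ∀ r, 0 < r → p (η r) = 0 ∨ k * r ≤ η' r) :
    ∫⁻ r in Set.Ioi (0 : ℝ), ENNReal.ofReal r * p (η r) ≤ ENNReal.ofReal k⁻¹ * ∫⁻ t, p t := by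
  have hmono : StrictMonoOn η (Set.Ioi 0) := by
    refine strictMonoOn_of_deriv_pos (convex_Ioi 0)
      (fun r _ => (hη r).continuousAt.continuousWithinAt) fun r hr => ?_
    rw [interior_Ioi] at hr
    rw [(hη r).deriv]; exact hpos r hr
  calc ∫⁻ r in Set.Ioi (0 : ℝ), ENNReal.ofReal r * p (η r)
      -- Wherever `p (η r)` is nonzero, `r ≤ k⁻¹ η' r`, so the polar weight is traded for the
      -- Jacobian.
      ≤ ∫⁻ r in Set.Ioi (0 : ℝ), ENNReal.ofReal k⁻¹ * (ENNReal.ofReal |η' r| * p (η r)) := by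
        refine setLIntegral_mono' measurableSet_Ioi fun r hr => ?_
        rcases hb r hr with h | h
        · simp [h]
        · rw [← mul_assoc, ← ENNReal.ofReal_mul (by positivity)]
          gcongr
          rw [abs_of_pos (hpos r hr), inv_mul_eq_div, le_div_iff₀ hk]
          linarith
    _ = ENNReal.ofReal k⁻¹ * ∫⁻ t in η '' Set.Ioi 0, p t := by
        rw [lintegral_const_mul' _ _ ENNReal.ofReal_ne_top,
          lintegral_image_eq_lintegral_abs_deriv_mul measurableSet_Ioi
            (fun r _ => (hη r).hasDerivWithinAt) hmono.injOn]
    _ ≤ _ := by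
        gcongr
        exact Measure.restrict_le_self

/-- One-dimensional change of variables, lower bound. -/
theorem le_lintegral_radial {η η' : ℝ → ℝ} {k : ℝ} (hk : 0 < k) {p : ℝ → ENNReal}
    (hη : ∀ r, HasDerivAt η (η' r) r) (hpos : ∀ r, 0 < r → 0 < η' r)
    (hb : ∀ r, 0 < r → p (η r) = 0 ∨ η' r ≤ k * r)
    (htop : Tendsto η atTop atTop) (hsupp : ∀ t, t < η 0 → p t = 0) :
    ∫⁻ t, p t ≤ ENNReal.ofReal k * ∫⁻ r in Set.Ioi (0 : ℝ), ENNReal.ofReal r * p (η r) := by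
  have hmono : StrictMonoOn η (Set.Ioi 0) := by
    refine strictMonoOn_of_deriv_pos (convex_Ioi 0)
      (fun r _ => (hη r).continuousAt.continuousWithinAt) fun r hr => ?_
    rw [interior_Ioi] at hr
    rw [(hη r).deriv]; exact hpos r hr
  have hcont : Continuous η := continuous_iff_continuousAt.2 fun r => (hη r).continuousAt
  have himage : Set.Ioi (η 0) ⊆ η '' Set.Ioi 0 := by
    intro t ht
    obtain ⟨R, hR⟩ := ((htop.eventually_ge_atTop t).and (eventually_ge_atTop 0)).exists
    obtain ⟨r, hr, rfl⟩ := intermediate_value_Icc hR.2 hcont.continuousOn ⟨le_of_lt ht, hR.1⟩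
    refine ⟨r, lt_of_le_of_ne hr.1 fun h => ?_, rfl⟩
    subst h
    exact lt_irrefl _ (Set.mem_Ioi.1 ht)
  calc ∫⁻ t, p t ≤ ∫⁻ t in η '' Set.Ioi 0, p t := by
        rw [← lintegral_indicator (measurableSet_Ioi.image_of_continuousOn_injOn hcont.continuousOn hmono.injOn)]
        -- The image of `Ioi 0` covers all of `Ioi (η 0)`, and `p` vanishes below `η 0`; only the
        -- null point `η 0` is left over.
        have hne : ∀ᵐ t : ℝ, t ≠ η 0 := compl_mem_ae_iff.2 (measure_singleton _)
        refine lintegral_mono_ae (hne.mono fun t ht0 => ?_)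
        rcases ht0.lt_or_gt with ht | ht
        · simp [hsupp t ht]
        · rw [Set.indicator_of_mem (himage ht)]
    _ = ∫⁻ r in Set.Ioi (0 : ℝ), ENNReal.ofReal |η' r| * p (η r) :=
        lintegral_image_eq_lintegral_abs_deriv_mul measurableSet_Ioi
            (fun r _ => (hη r).hasDerivWithinAt) hmono.injOn _
    _ ≤ ∫⁻ r in Set.Ioi (0 : ℝ), ENNReal.ofReal k * (ENNReal.ofReal r * p (η r)) := by
        refine setLIntegral_mono' measurableSet_Ioi fun r hr => ?_
        rcases hb r hr with h | h
        · simp [h]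
        · rw [← mul_assoc, ← ENNReal.ofReal_mul hk.le]
          gcongr
          rwa [abs_of_pos (hpos r hr)]
    _ = _ := by rw [lintegral_const_mul' _ _ ENNReal.ofReal_ne_top]

/-! ### Second derivatives of a convex function -/

section Convexity

variable {φ : Plane → ℝ}

theorem hasDerivAt_line (hφ : ContDiff ℝ 2 φ) (x e : Plane) (t : ℝ) :
    HasDerivAt (fun t : ℝ => φ (x + t • e)) (fderiv ℝ φ (x + t • e) e) t := by
  have h1 : HasDerivAt (fun t : ℝ => x + t • e) e t := by
    simpa using ((hasDerivAt_id t).smul_const e).const_add x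
  exact ((hφ.differentiable (by norm_num)) (x + t • e)).hasFDerivAt.comp_hasDerivAt t h1

theorem hasDerivAt_fderiv_line (hφ : ContDiff ℝ 2 φ) (x e : Plane) (t : ℝ) :
    HasDerivAt (fun t : ℝ => fderiv ℝ φ (x + t • e) e)
      (fderiv ℝ (fderiv ℝ φ) (x + t • e) e e) t := by
  have h1 : HasDerivAt (fun t : ℝ => x + t • e) e t := by
    simpa using ((hasDerivAt_id t).smul_const e).const_add x
  have h2 : ContDiff ℝ 1 (fderiv ℝ φ) := hφ.fderiv_right (by norm_num)
  have h3 := ((h2.differentiable (by norm_num)) (x + t • e)).hasFDerivAt.comp_hasDerivAt t h1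
  simpa using h3.clm_apply (hasDerivAt_const t e)

theorem monotone_fderiv_line (hφ : ContDiff ℝ 2 φ) (hc : ConvexOn ℝ Set.univ φ) (x e : Plane) :
    Monotone fun t : ℝ => fderiv ℝ φ (x + t • e) e := by
  have h1 : ConvexOn ℝ Set.univ fun t : ℝ => φ (x + t • e) := by
    have := hc.comp_affineMap (AffineMap.lineMap x (x + e) : ℝ →ᵃ[ℝ] Plane)
    simpa [Function.comp_def, AffineMap.lineMap_apply, add_comm] using this
  have h2 := h1.monotoneOn_deriv fun t _ => (hasDerivAt_line hφ x e t).differentiableAt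
  intro s t hst
  have := h2 (Set.mem_univ s) (Set.mem_univ t) hst
  rwa [(hasDerivAt_line hφ x e s).deriv, (hasDerivAt_line hφ x e t).deriv] at this

theorem hessian_nonneg (hφ : ContDiff ℝ 2 φ) (hc : ConvexOn ℝ Set.univ φ) (x e : Plane) :
    0 ≤ fderiv ℝ (fderiv ℝ φ) x e e := by
  have h := hasDerivAt_fderiv_line hφ x e 0
  rw [zero_smul, add_zero] at h
  rw [← h.deriv]
  exact (monotone_fderiv_line hφ hc x e).deriv_nonneg

/-- A nonzero Hessian of a convex function is positive in one of the coordinate directions. -/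
theorem exists_hessian_diag_pos (hφ : ContDiff ℝ 2 φ) (hc : ConvexOn ℝ Set.univ φ) (x : Plane)
    (hx : hessian φ x ≠ 0) :
    ∃ i : Fin 2, 0 < fderiv ℝ (fderiv ℝ φ) x (EuclideanSpace.single i 1)
      (EuclideanSpace.single i 1) := by
  by_contra! hcon
  have hd : ∀ i : Fin 2, fderiv ℝ (fderiv ℝ φ) x (EuclideanSpace.single i 1)
      (EuclideanSpace.single i 1) = 0 := fun i => le_antisymm (hcon i) (hessian_nonneg hφ hc _ _)
  set a : Plane := EuclideanSpace.single 0 1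
  set b : Plane := EuclideanSpace.single 1 1
  have hsymm : fderiv ℝ (fderiv ℝ φ) x a b = fderiv ℝ (fderiv ℝ φ) x b a :=
    (hφ.contDiffAt.isSymmSndFDerivAt (by simp)) a b
  -- With a vanishing diagonal, the form at `a + b` and `a - b` is plus and minus twice the
  -- off-diagonal entry, which nonnegativity forces to be zero.
  have h1 := hessian_nonneg hφ hc x (a + b)
  have h2 := hessian_nonneg hφ hc x (a - b)
  have ha := hd 0
  have hb := hd 1
  simp only [map_add, map_sub, add_apply, sub_apply]
    at h1 h2
  have hab : fderiv ℝ (fderiv ℝ φ) x a b = 0 := by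
    change fderiv ℝ (fderiv ℝ φ) x a a = 0 at ha
    change fderiv ℝ (fderiv ℝ φ) x b b = 0 at hb
    linarith
  apply hx
  ext i j
  fin_cases i <;> fin_cases j
  · exact ha
  · exact hab
  · exact hsymm.symm.trans hab
  · exact hb

end Convexity

/-! ### The law of the phase at fixed midpoint -/

/-- The phase `|y|² + φ(y)`, whose graph carries the projection measure. -/
noncomputable def phase (φ : Plane → ℝ) (y : Plane) : ℝ := ‖y‖ ^ 2 + φ y

/-- The sum of the phases at the two points with midpoint `x` and half-difference `w`. -/
noncomputable def pairPhase (φ : Plane → ℝ) (x w : Plane) : ℝ := phase φ (x + w) + phase φ (x - w)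

section Slices

variable {φ : Plane → ℝ}

theorem continuous_phase (hφ : Continuous φ) : Continuous (phase φ) := by
  unfold phase; fun_prop

theorem continuous_pairPhase (hφ : Continuous φ) (x : Plane) : Continuous (pairPhase φ x) := by
  have := continuous_phase hφ
  unfold pairPhase; fun_prop

theorem pairPhase_eq (φ : Plane → ℝ) (x w : Plane) :
    pairPhase φ x w = 2 * ‖x‖ ^ 2 + 2 * ‖w‖ ^ 2 + (φ (x + w) + φ (x - w)) := by
  have := parallelogram_law_with_norm ℝ x w
  unfold pairPhase phase
  nlinarith

theorem pairPhase_smul {e : Plane} (he : ‖e‖ = 1) (x : Plane) (r : ℝ) :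
    pairPhase φ x (r • e) = 2 * ‖x‖ ^ 2 + 2 * r ^ 2 + (φ (x + r • e) + φ (x + (-r) • e)) := by
  rw [pairPhase_eq, norm_smul, he, mul_one, Real.norm_eq_abs, sq_abs, neg_smul, sub_eq_add_neg]

/-- The part of the radial derivative of `pairPhase` contributed by the perturbation. -/
noncomputable def gradGap (φ : Plane → ℝ) (x e : Plane) (r : ℝ) : ℝ :=
  fderiv ℝ φ (x + r • e) e - fderiv ℝ φ (x + (-r) • e) e

/-- The term `4 r` comes from the paraboloid alone, so bounds for the density reduce to bounds for
`gradGap`. -/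
theorem hasDerivAt_pairPhase (hφ : ContDiff ℝ 2 φ) {e : Plane} (he : ‖e‖ = 1) (x : Plane) (r : ℝ) :
    HasDerivAt (fun r : ℝ => pairPhase φ x (r • e)) (4 * r + gradGap φ x e r) r := by
  simp only [pairPhase_smul he]
  have h1 := hasDerivAt_line hφ x e r
  have h2 : HasDerivAt (fun r : ℝ => φ (x + (-r) • e)) (-fderiv ℝ φ (x + (-r) • e) e) r := by
    simpa [Function.comp_def] using (hasDerivAt_line hφ x e (-r)).scomp r (hasDerivAt_neg r)
  have h3 : HasDerivAt (fun r : ℝ => 2 * ‖x‖ ^ 2 + 2 * r ^ 2) (4 * r) r := by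
    have := ((hasDerivAt_pow 2 r).const_mul 2).const_add (2 * ‖x‖ ^ 2)
    exact this.congr_deriv (by norm_num; ring)
  exact h3.add (h1.add h2)

theorem hasDerivAt_gradGap (hφ : ContDiff ℝ 2 φ) (x e : Plane) (r : ℝ) :
    HasDerivAt (gradGap φ x e) (fderiv ℝ (fderiv ℝ φ) (x + r • e) e e +
      fderiv ℝ (fderiv ℝ φ) (x + (-r) • e) e e) r := by
  have h2 : HasDerivAt (fun r : ℝ => fderiv ℝ φ (x + (-r) • e) e)
      (-fderiv ℝ (fderiv ℝ φ) (x + (-r) • e) e e) r := by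
    simpa [Function.comp_def] using
      (hasDerivAt_fderiv_line hφ x e (-r)).scomp r (hasDerivAt_neg r)
  exact ((hasDerivAt_fderiv_line hφ x e r).sub h2).congr_deriv (sub_neg_eq_add _ _)

theorem gradGap_zero (x e : Plane) : gradGap φ x e 0 = 0 := by simp [gradGap]

theorem monotone_gradGap (hφ : ContDiff ℝ 2 φ) (hc : ConvexOn ℝ Set.univ φ) (x e : Plane) :
    Monotone (gradGap φ x e) := fun _ _ hst =>
  sub_le_sub (monotone_fderiv_line hφ hc x e hst)
    (monotone_fderiv_line hφ hc x e (neg_le_neg hst))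

theorem gradGap_nonneg (hφ : ContDiff ℝ 2 φ) (hc : ConvexOn ℝ Set.univ φ) (x e : Plane) {r : ℝ}
    (hr : 0 ≤ r) : 0 ≤ gradGap φ x e r :=
  (gradGap_zero (φ := φ) x e).symm.le.trans (monotone_gradGap hφ hc x e hr)

/-- Mean value inequality: the derivative of `gradGap` is a sum of two second derivatives along the
line, hence the factor `2`. -/
theorem mul_le_gradGap (hφ : ContDiff ℝ 2 φ) (x e : Plane) {r c : ℝ} (hr : 0 ≤ r)
    (h : ∀ t, |t| ≤ r → c ≤ fderiv ℝ (fderiv ℝ φ) (x + t • e) e e) :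
    2 * c * r ≤ gradGap φ x e r := by
  have hd := hasDerivAt_gradGap hφ x e
  have := (convex_Icc 0 r).mul_sub_le_image_sub_of_le_deriv (f := gradGap φ x e) (C := 2 * c)
    (fun t _ => (hd t).continuousAt.continuousWithinAt)
    (fun t _ => (hd t).differentiableAt.differentiableWithinAt)
    (fun t ht => by
      rw [interior_Icc] at ht
      rw [(hd t).deriv]
      have h1 := h t (abs_le.2 ⟨by linarith [ht.1], ht.2.le⟩)
      have h2 := h (-t) (abs_le.2 ⟨by linarith [ht.2], by linarith [ht.1]⟩)
      linarith) 0 (Set.left_mem_Icc.2 hr) r (Set.right_mem_Icc.2 hr) hr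
  simpa [gradGap_zero] using this

theorem gradGap_le_mul (hφ : ContDiff ℝ 2 φ) (x e : Plane) {r c : ℝ} (hr : 0 ≤ r)
    (h : ∀ t, |t| ≤ r → fderiv ℝ (fderiv ℝ φ) (x + t • e) e e ≤ c) :
    gradGap φ x e r ≤ 2 * c * r := by
  have hd := hasDerivAt_gradGap hφ x e
  have := (convex_Icc 0 r).image_sub_le_mul_sub_of_deriv_le (f := gradGap φ x e) (C := 2 * c)
    (fun t _ => (hd t).continuousAt.continuousWithinAt)
    (fun t _ => (hd t).differentiableAt.differentiableWithinAt)
    (fun t ht => by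
      rw [interior_Icc] at ht
      rw [(hd t).deriv]
      have h1 := h t (abs_le.2 ⟨by linarith [ht.1], ht.2.le⟩)
      have h2 := h (-t) (abs_le.2 ⟨by linarith [ht.2], by linarith [ht.1]⟩)
      linarith) 0 (Set.left_mem_Icc.2 hr) r (Set.right_mem_Icc.2 hr) hr
  simpa [gradGap_zero] using this

/-- Upper bound for the distribution of `pairPhase φ x`, improved by a sector of directions in which
`φ` is uniformly convex. -/
theorem lintegral_pairPhase_le (hφ : ContDiff ℝ 2 φ) (hc : ConvexOn ℝ Set.univ φ) (x : Plane)
    {α β c : ℝ} (hα : -Real.pi ≤ α) (hαβ : α ≤ β) (hβ : β ≤ Real.pi) (hc0 : 0 ≤ c)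
    {p : ℝ → ENNReal} (hp : Measurable p)
    (hb : ∀ θ ∈ Set.Ioo α β, ∀ r : ℝ, 0 < r → p (pairPhase φ x (r • unitVec θ)) = 0 ∨
      c * r ≤ gradGap φ x (unitVec θ) r) :
    ∫⁻ w, p (pairPhase φ x w) ≤
      ENNReal.ofReal (Real.pi / 2 - (β - α) * (4⁻¹ - (4 + c)⁻¹)) * ∫⁻ t, p t := by
  have hder := fun θ => hasDerivAt_pairPhase hφ (norm_unitVec θ) x
  have hgap := fun θ (r : ℝ) (hr : 0 < r) => gradGap_nonneg hφ hc x (unitVec θ) hr.le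
  have hsub : Set.Ioo α β ⊆ Set.Ioo (-Real.pi) Real.pi := Set.Ioo_subset_Ioo hα hβ
  rw [lintegral_plane_polar (G := fun w => p (pairPhase φ x w))
    (hp.comp (continuous_pairPhase hφ.continuous x).measurable),
    ← lintegral_inter_add_sdiff _ _ (measurableSet_Ioo (a := α) (b := β)),
    Set.inter_eq_self_of_subset_right hsub]
  -- Each direction in the sector costs `1 / (4 + c)` and each remaining one `1 / 4`; together these
  -- give the stated constant.
  have h1 : ∫⁻ θ in Set.Ioo α β, ∫⁻ r in Set.Ioi (0 : ℝ), ENNReal.ofReal r *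
      p (pairPhase φ x (r • unitVec θ)) ≤
      ENNReal.ofReal ((β - α) * (4 + c)⁻¹) * ∫⁻ t, p t := by
    calc _ ≤ ∫⁻ θ in Set.Ioo α β, ENNReal.ofReal (4 + c)⁻¹ * ∫⁻ t, p t := by
          refine setLIntegral_mono' measurableSet_Ioo fun θ hθ => ?_
          refine lintegral_radial_le (by linarith) (hder θ)
            (fun r hr => by linarith [hgap θ r hr]) fun r hr => (hb θ hθ r hr).imp id fun h => ?_
          linarith
      _ = _ := by
          rw [setLIntegral_const, Real.volume_Ioo, mul_comm (β - α),
            ENNReal.ofReal_mul (by positivity)]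
          ring
  have h2 : ∫⁻ θ in Set.Ioo (-Real.pi) Real.pi \ Set.Ioo α β, ∫⁻ r in Set.Ioi (0 : ℝ),
      ENNReal.ofReal r * p (pairPhase φ x (r • unitVec θ)) ≤
      ENNReal.ofReal ((2 * Real.pi - (β - α)) * 4⁻¹) * ∫⁻ t, p t := by
    calc _ ≤ ∫⁻ θ in Set.Ioo (-Real.pi) Real.pi \ Set.Ioo α β,
            ENNReal.ofReal 4⁻¹ * ∫⁻ t, p t := by
          refine setLIntegral_mono' (measurableSet_Ioo.diff measurableSet_Ioo) fun θ _ => ?_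
          exact lintegral_radial_le (by norm_num) (hder θ)
            (fun r hr => by linarith [hgap θ r hr])
            fun r hr => Or.inr (by linarith [hgap θ r hr])
      _ = _ := by
          rw [setLIntegral_const, measure_sdiff hsub measurableSet_Ioo.nullMeasurableSet
            measure_Ioo_lt_top.ne, Real.volume_Ioo, Real.volume_Ioo,
            ← ENNReal.ofReal_sub _ (by linarith), mul_comm _ (4⁻¹ : ℝ),
            ENNReal.ofReal_mul (by positivity), show Real.pi - -Real.pi - (β - α) =
              2 * Real.pi - (β - α) by ring]
          ring
  refine (add_le_add h1 h2).trans_eq ?_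
  rw [← add_mul, ← ENNReal.ofReal_add (mul_nonneg (by linarith) (by positivity))
    (mul_nonneg (by linarith) (by positivity))]
  congr 2
  ring

/-- Lower bound for the distribution of `pairPhase φ x` where `φ` has small second derivatives. -/
theorem le_lintegral_pairPhase (hφ : ContDiff ℝ 2 φ) (hc : ConvexOn ℝ Set.univ φ)
    (hφ0 : ∀ y, 0 ≤ φ y) (x : Plane) {c : ℝ} (hc0 : 0 ≤ c) {p : ℝ → ENNReal} (hp : Measurable p)
    (hsupp : ∀ t, t < pairPhase φ x 0 → p t = 0)
    (hb : ∀ θ r : ℝ, 0 < r → p (pairPhase φ x (r • unitVec θ)) = 0 ∨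
      gradGap φ x (unitVec θ) r ≤ c * r) :
    ENNReal.ofReal (2 * Real.pi * (4 + c)⁻¹) * ∫⁻ t, p t ≤ ∫⁻ w, p (pairPhase φ x w) := by
  have hder := fun θ => hasDerivAt_pairPhase hφ (norm_unitVec θ) x
  have hgap := fun θ (r : ℝ) (hr : 0 < r) => gradGap_nonneg hφ hc x (unitVec θ) hr.le
  rw [lintegral_plane_polar (G := fun w => p (pairPhase φ x w))
    (hp.comp (continuous_pairPhase hφ.continuous x).measurable)]
  calc _ = ∫⁻ θ in Set.Ioo (-Real.pi) Real.pi, ENNReal.ofReal (4 + c)⁻¹ * ∫⁻ t, p t := by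
        rw [setLIntegral_const, Real.volume_Ioo, ENNReal.ofReal_mul (by positivity),
          show Real.pi - -Real.pi = 2 * Real.pi by ring]
        ring
    _ ≤ _ := by
        refine setLIntegral_mono' measurableSet_Ioo fun θ _ => ?_
        -- Since `φ ≥ 0`, the phase is at least `2 r²`, which exceeds `r - 1`.
        have htop : Tendsto (fun r : ℝ => pairPhase φ x (r • unitVec θ)) atTop atTop := by
          refine tendsto_atTop_mono (f := fun r : ℝ => r + -1) (fun r => ?_)
            (tendsto_atTop_add_const_right _ _ tendsto_id)
          rw [pairPhase_smul (norm_unitVec θ)]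
          nlinarith [hφ0 (x + r • unitVec θ), hφ0 (x + (-r) • unitVec θ), sq_nonneg ‖x‖,
            sq_nonneg (r - 1), sq_nonneg r]
        have := le_lintegral_radial (k := 4 + c) (by linarith) (p := p) (hder θ)
          (fun r hr => by linarith [hgap θ r hr])
          (fun r hr => (hb θ r hr).imp id fun h => by linarith) htop (by simpa using hsupp)
        rw [ENNReal.ofReal_inv_of_pos (by linarith)]
        calc _ ≤ (ENNReal.ofReal (4 + c))⁻¹ * (ENNReal.ofReal (4 + c) * _) := by gcongr
          _ = _ := by
            rw [← mul_assoc, ENNReal.inv_mul_cancel (by simp; linarith) ENNReal.ofReal_ne_top,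
              one_mul]

/-- For midpoints in a compact set and bounded phases, the nonvanishing of the Hessian improves the
constant `π / 2` uniformly. -/
theorem exists_lintegral_pairPhase_le (hφ : ContDiff ℝ 2 φ) (hc : ConvexOn ℝ Set.univ φ)
    (hφ0 : ∀ y, 0 ≤ φ y) (hH : ∀ y, hessian φ y ≠ 0) {K : Set Plane} (hK : IsCompact K) (T : ℝ) :
    ∃ δ : ℝ, 0 < δ ∧ ∀ x ∈ K, ∀ p : ℝ → ENNReal, Measurable p → (∀ t, T < t → p t = 0) →
      ∫⁻ w, p (pairPhase φ x w) ≤ ENNReal.ofReal (Real.pi / 2 - δ) * ∫⁻ t, p t := by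
  -- The existence of some `δ` passes to subsets and, by taking minima, to finite unions, so it
  -- suffices to find one near each midpoint.
  refine hK.induction_on (p := fun s => ∃ δ : ℝ, 0 < δ ∧ ∀ x ∈ s, ∀ p : ℝ → ENNReal,
    Measurable p → (∀ t, T < t → p t = 0) →
      ∫⁻ w, p (pairPhase φ x w) ≤ ENNReal.ofReal (Real.pi / 2 - δ) * ∫⁻ t, p t) ?_ ?_ ?_ ?_
  · exact ⟨1, one_pos, by simp⟩
  · rintro s t hst ⟨δ, hδ, h⟩
    exact ⟨δ, hδ, fun x hx => h x (hst hx)⟩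
  · rintro s t ⟨δ, hδ, h⟩ ⟨δ', hδ', h'⟩
    refine ⟨min δ δ', lt_min hδ hδ', fun x hx p hp hpT => ?_⟩
    rcases hx with hx | hx
    · refine (h x hx p hp hpT).trans ?_
      gcongr
      exact min_le_left _ _
    · refine (h' x hx p hp hpT).trans ?_
      gcongr
      exact min_le_right _ _
  intro x₀ _
  have hQ : Continuous fun z : Plane × ℝ =>
      fderiv ℝ (fderiv ℝ φ) z.1 (unitVec z.2) (unitVec z.2) := by
    have h2 : ContDiff ℝ 1 (fderiv ℝ φ) := hφ.fderiv_right (by norm_num)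
    have h3 : Continuous (fderiv ℝ (fderiv ℝ φ)) := h2.continuous_fderiv (by norm_num)
    have := continuous_unitVec
    fun_prop
  obtain ⟨θ₀, h0, hpi, hpos⟩ : ∃ θ₀ : ℝ, 0 ≤ θ₀ ∧ θ₀ ≤ Real.pi / 2 ∧
      0 < fderiv ℝ (fderiv ℝ φ) x₀ (unitVec θ₀) (unitVec θ₀) := by
    obtain ⟨i, hi⟩ := exists_hessian_diag_pos hφ hc x₀ (hH x₀)
    fin_cases i
    · exact ⟨0, le_rfl, by positivity, by rw [unitVec_zero]; exact hi⟩
    · exact ⟨Real.pi / 2, by positivity, le_rfl, by rw [unitVec_pi_div_two]; exact hi⟩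
  -- Half the value at `(x₀, θ₀)` remains a lower bound for nearby points and angles.
  set c₀ := fderiv ℝ (fderiv ℝ φ) x₀ (unitVec θ₀) (unitVec θ₀) / 2 with hc₀
  have hev : ∀ᶠ z : Plane × ℝ in 𝓝 (x₀, θ₀),
      c₀ < fderiv ℝ (fderiv ℝ φ) z.1 (unitVec z.2) (unitVec z.2) :=
    hQ.continuousAt.eventually (lt_mem_nhds (by simp only [hc₀]; linarith))
  obtain ⟨ε', hε', hball⟩ := Metric.eventually_nhds_iff.1 hev
  -- Since `θ₀` lies in `[0, π / 2]`, the cap `ε ≤ 1` keeps the sector inside `(-π, π)`.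
  set ε := min ε' 1
  have hε : 0 < ε := lt_min hε' one_pos
  have hε1 : ε ≤ 1 := min_le_right _ _
  have hQ' : ∀ y θ, dist y x₀ < ε → |θ - θ₀| < ε →
      c₀ < fderiv ℝ (fderiv ℝ φ) y (unitVec θ) (unitVec θ) := fun y θ hy hθ =>
    hball (y := (y, θ)) (by
      rw [Prod.dist_eq, Real.dist_eq]
      exact max_lt (hy.trans_le (min_le_left _ _)) (hθ.trans_le (min_le_left _ _)))
  have hc₀pos : 0 < c₀ := half_pos hpos
  -- If the phase is at most `T`, then `2 r² ≤ T`, so `r ≤ R`.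
  set R := max 1 T
  have hR1 : 1 ≤ R := le_max_left _ _
  have hRT : T ≤ R := le_max_right _ _
  -- For `r ≤ ε / 4` the gap is at least `2 c₀ r`. Beyond that, monotonicity keeps it at least `c₀ ε
  -- / 2 = c R ≥ c r`.
  set c := c₀ * ε / (2 * R) with hcdef
  have hcpos : 0 < c := by positivity
  have hcR : c * R = c₀ * ε / 2 := by rw [hcdef]; field_simp
  have hcc : c ≤ 2 * c₀ := by nlinarith
  have hpi3 := Real.pi_gt_three
  have hδ : 0 < 2 * ε * (4⁻¹ - (4 + c)⁻¹) := by
    have : (4 + c)⁻¹ < 4⁻¹ := inv_strictAnti₀ (by norm_num) (by linarith)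
    have := sub_pos.2 this
    positivity
  refine ⟨Metric.ball x₀ (ε / 2), mem_nhdsWithin_of_mem_nhds (Metric.ball_mem_nhds _ (by positivity)),
    _, hδ, fun x hx p hp hpT => ?_⟩
  have key := lintegral_pairPhase_le hφ hc x (α := θ₀ - ε) (β := θ₀ + ε) (by linarith)
    (by linarith) (by linarith) hcpos.le hp ?_
  · rwa [show θ₀ + ε - (θ₀ - ε) = 2 * ε by ring] at key
  intro θ hθ r hr
  have hθ' : |θ - θ₀| < ε := abs_lt.2 ⟨by linarith [hθ.1], by linarith [hθ.2]⟩
  by_cases hT : T < pairPhase φ x (r • unitVec θ)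
  · exact Or.inl (hpT _ hT)
  right
  have hrR : r ≤ R := by
    rw [pairPhase_smul (norm_unitVec θ)] at hT
    by_contra! hlt
    have := hφ0 (x + r • unitVec θ)
    have := hφ0 (x + (-r) • unitVec θ)
    nlinarith [sq_nonneg ‖x‖]
  have hsmall : ∀ s : ℝ, 0 ≤ s → s ≤ ε / 4 → 2 * c₀ * s ≤ gradGap φ x (unitVec θ) s := by
    intro s hs hsε
    refine mul_le_gradGap hφ x _ hs fun t ht => (hQ' _ _ ?_ hθ').le
    have h1 : dist (x + t • unitVec θ) x = |t| := by
      rw [dist_eq_norm, add_sub_cancel_left, norm_smul, norm_unitVec, mul_one, Real.norm_eq_abs]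
    have h2 := dist_triangle (x + t • unitVec θ) x x₀
    have h3 : dist x x₀ < ε / 2 := hx
    linarith
  rcases le_total r (ε / 4) with h | h
  · nlinarith [hsmall r hr.le h]
  · have h1 := monotone_gradGap hφ hc x (unitVec θ) h
    have h2 := hsmall (ε / 4) (by positivity) le_rfl
    nlinarith

end Slices

/-! ### Densities of pushforwards by duality -/

section Duality

variable {α β : Type*} [MeasurableSpace α] [MeasurableSpace β] {μ : Measure α} {ν : Measure β}

/-- This is `k⁻¹ (‖a‖ - k ‖b‖)² ≥ 0`. The weight stays free so that it can later be a density bound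
varying from point to point. -/
theorem two_mul_enorm_mul_le (a b : ℂ) {k : ℝ} (hk : 0 < k) :
    2 * (‖a‖ₑ * ‖b‖ₑ) ≤ ENNReal.ofReal k⁻¹ * ‖a‖ₑ ^ 2 + ENNReal.ofReal k * ‖b‖ₑ ^ 2 := by
  have h : 2 * (‖a‖ * ‖b‖) ≤ k⁻¹ * ‖a‖ ^ 2 + k * ‖b‖ ^ 2 := by
    have h1 : k⁻¹ * ‖a‖ ^ 2 + k * ‖b‖ ^ 2 - 2 * (‖a‖ * ‖b‖) = k⁻¹ * (‖a‖ - k * ‖b‖) ^ 2 := by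
      field_simp
      ring
    have h2 : 0 ≤ k⁻¹ * (‖a‖ - k * ‖b‖) ^ 2 := by positivity
    linarith
  have h3 := ENNReal.ofReal_le_ofReal h
  rw [ENNReal.ofReal_add (by positivity) (by positivity), ENNReal.ofReal_mul (by norm_num),
    ENNReal.ofReal_mul (by positivity), ENNReal.ofReal_mul (by positivity),
    ENNReal.ofReal_mul (by positivity), ENNReal.ofReal_pow (by positivity),
    ENNReal.ofReal_pow (by positivity)] at h3
  simpa using h3

theorem enorm_integral_mul_le {f g : β → ℂ} (hf : AEStronglyMeasurable f ν)
    {k : β → ℝ} (hk : ∀ x, 0 < k x) (hkm : Measurable k) :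
    2 * ‖∫ x, f x * g x ∂ν‖ₑ ≤ ∫⁻ x, ENNReal.ofReal (k x)⁻¹ * ‖f x‖ₑ ^ 2 ∂ν +
      ∫⁻ x, ENNReal.ofReal (k x) * ‖g x‖ₑ ^ 2 ∂ν := by
  calc 2 * ‖∫ x, f x * g x ∂ν‖ₑ ≤ 2 * ∫⁻ x, ‖f x * g x‖ₑ ∂ν := by
        gcongr
        exact enorm_integral_le_lintegral_enorm _
    _ = ∫⁻ x, 2 * (‖f x‖ₑ * ‖g x‖ₑ) ∂ν := by
        rw [lintegral_const_mul' _ _ (by norm_num)]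
        simp only [enorm_mul]
    _ ≤ ∫⁻ x, (ENNReal.ofReal (k x)⁻¹ * ‖f x‖ₑ ^ 2 + ENNReal.ofReal (k x) * ‖g x‖ₑ ^ 2) ∂ν :=
        lintegral_mono fun x => two_mul_enorm_mul_le _ _ (hk x)
    _ = _ := by
        rw [lintegral_add_left' (by fun_prop)]

theorem MemLp.comp_of_map_le {Φ : α → β} (hΦ : Measurable Φ) {C : ENNReal} (hC : C ≠ ⊤)
    (hle : μ.map Φ ≤ C • ν) {g : β → ℂ} (hg : MemLp g 2 ν) : MemLp (fun x => g (Φ x)) 2 μ := by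
  have h1 : MemLp g 2 (μ.map Φ) := hg.of_measure_le_smul hC hle
  exact h1.comp_of_map hΦ.aemeasurable

/-- If the image of `μ` under `Φ` is dominated by `ν`, the complex measure `Φ_*(u μ)` with `u ∈ L²(μ)`
has a square integrable density with respect to `ν`. -/
theorem exists_memLp_density {Φ : α → β} (hΦ : Measurable Φ) {C : ENNReal} (hC : C ≠ ⊤)
    (hle : μ.map Φ ≤ C • ν) {u : α → ℂ} (hu : MemLp u 2 μ) :
    ∃ F : β → ℂ, MemLp F 2 ν ∧
      ∀ g : β → ℂ, MemLp g 2 ν → ∫ z, g z * F z ∂ν = ∫ x, g (Φ x) * u x ∂μ := by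
  have hmem : ∀ g : Lp ℂ 2 ν, MemLp (fun x => g (Φ x)) 2 μ := fun g =>
    MemLp.comp_of_map_le hΦ hC hle (Lp.memLp g)
  have hac : μ.map Φ ≪ ν :=
    (Measure.absolutelyContinuous_of_le hle).trans (Measure.smul_absolutelyContinuous)
  have hqmp : Measure.QuasiMeasurePreserving Φ μ ν := ⟨hΦ, hac⟩
  let T₀ : Lp ℂ 2 ν →ₗ[ℂ] Lp ℂ 2 μ :=
    { toFun := fun g => (hmem g).toLp
      map_add' := fun g h => by
        rw [← MemLp.toLp_add]
        exact MemLp.toLp_congr _ _ (hqmp.ae_eq_comp (Lp.coeFn_add g h))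
      map_smul' := fun c g => by
        rw [RingHom.id_apply, ← MemLp.toLp_const_smul]
        exact MemLp.toLp_congr _ _ (hqmp.ae_eq_comp (Lp.coeFn_smul c g)) }
  have hbound : ∀ g : Lp ℂ 2 ν, ‖T₀ g‖ ≤ (C ^ (1 / 2 : ℝ)).toReal * ‖g‖ := by
    intro g
    change ‖(hmem g).toLp‖ ≤ _
    rw [Lp.norm_toLp, Lp.norm_def, ← ENNReal.toReal_mul]
    refine ENNReal.toReal_mono
      (ENNReal.mul_ne_top (ENNReal.rpow_ne_top_of_nonneg (by norm_num) hC) (Lp.eLpNorm_ne_top g)) ?_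
    have h1 : eLpNorm (fun x => g (Φ x)) 2 μ = eLpNorm g 2 (μ.map Φ) :=
      (eLpNorm_map_measure ((Lp.aestronglyMeasurable g).mono_ac hac) hΦ.aemeasurable).symm
    rw [h1]
    refine (eLpNorm_mono_measure _ hle).trans_eq ?_
    rw [eLpNorm_smul_measure_of_ne_top (by norm_num)]
    simp
  let T : Lp ℂ 2 ν →L[ℂ] Lp ℂ 2 μ := T₀.mkContinuous _ hbound
  have hū : MemLp (fun x => (starRingEnd ℂ) (u x)) 2 μ := hu.star
  -- The Riesz representative of `g ↦ ⟪conj u, g ∘ Φ⟫`. The required pairing is bilinear while the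
  -- inner product is conjugate-linear on the left, hence the conjugates on `u` and `F₀`.
  let F₀ : Lp ℂ 2 ν := (InnerProductSpace.toDual ℂ (Lp ℂ 2 ν)).symm
    ((innerSL ℂ (hū.toLp)).comp T)
  refine ⟨fun z => (starRingEnd ℂ) (F₀ z), (Lp.memLp F₀).star, fun g hg => ?_⟩
  have h1 : inner ℂ F₀ hg.toLp = inner ℂ (hū.toLp) (T hg.toLp) := by
    rw [InnerProductSpace.toDual_symm_apply]
    rfl
  rw [L2.inner_def, L2.inner_def] at h1
  calc ∫ z, g z * (starRingEnd ℂ) (F₀ z) ∂ν = ∫ z, inner ℂ (F₀ z) ((hg.toLp : Lp ℂ 2 ν) z) ∂ν := by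
        refine integral_congr_ae ?_
        filter_upwards [hg.coeFn_toLp] with z hz
        rw [hz]
        simp
    _ = ∫ x, inner ℂ ((hū.toLp : Lp ℂ 2 μ) x) ((T hg.toLp : Lp ℂ 2 μ) x) ∂μ := h1
    _ = _ := by
        refine integral_congr_ae ?_
        have h2 : (T hg.toLp : α → ℂ) =ᵐ[μ] fun x => (hg.toLp : Lp ℂ 2 ν) (Φ x) := (hmem hg.toLp).coeFn_toLp
        filter_upwards [hū.coeFn_toLp, h2, hqmp.ae_eq_comp hg.coeFn_toLp] with x hx hx2 hx3
        rw [hx, hx2]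
        simp only [Function.comp_apply] at hx3
        rw [hx3]
        simp

/-- The `L²` norm of the density of `Φ_*(u μ)`, when the density of `Φ_* μ` is at most `k`. -/
theorem lintegral_density_le {Φ : α → β} (hΦ : Measurable Φ) {k : β → ℝ} (hk : ∀ z, 0 < k z)
    (hkm : Measurable k) (hle : μ.map Φ ≤ ν.withDensity fun z => ENNReal.ofReal (k z))
    {u : α → ℂ} {F : β → ℂ} (hF : MemLp F 2 ν)
    (hF' : AEStronglyMeasurable (fun x => F (Φ x)) μ)
    (hpair : ∀ g : β → ℂ, MemLp g 2 ν → ∫ z, g z * F z ∂ν = ∫ x, g (Φ x) * u x ∂μ) :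
    ∫⁻ z, ‖F z‖ₑ ^ 2 ∂ν ≤ ∫⁻ x, ENNReal.ofReal (k (Φ x)) * ‖u x‖ₑ ^ 2 ∂μ := by
  have hsq : ∀ z, ‖F z‖ₑ ^ 2 = ENNReal.ofReal (‖F z‖ ^ 2) := fun z => by
    rw [ENNReal.ofReal_pow (norm_nonneg _), ofReal_norm]
  have hint : Integrable (fun z => ‖F z‖ ^ 2) ν := hF.integrable_norm_pow (by norm_num)
  have hN : ∫⁻ z, ‖F z‖ₑ ^ 2 ∂ν = ‖∫ z, (starRingEnd ℂ) (F z) * F z ∂ν‖ₑ := by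
    have h1 : ∫ z, (starRingEnd ℂ) (F z) * F z ∂ν = ((∫ z, ‖F z‖ ^ 2 ∂ν : ℝ) : ℂ) := by
      rw [← integral_complex_ofReal]
      refine integral_congr_ae (ae_of_all _ fun z => ?_)
      simp only [Complex.conj_mul', Complex.ofReal_pow]
    rw [h1, ← ofReal_norm, Complex.norm_real, Real.norm_of_nonneg
      (integral_nonneg fun z => by positivity),
      ofReal_integral_eq_lintegral_ofReal hint (ae_of_all _ fun z => by positivity)]
    simp only [hsq]
  have hfin : ∫⁻ z, ‖F z‖ₑ ^ 2 ∂ν ≠ ⊤ := by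
    simp only [hsq]
    exact hint.lintegral_lt_top.ne
  -- Let `N` be the integral of `‖F‖²`, obtained by testing against `conj F`. With weight `k ∘ Φ`
  -- the first term on the right is at most `N`, because `k⁻¹` cancels the density `k`. So `2 N` is
  -- at most `N` plus the claimed bound, and `N` is finite.
  have h2 := enorm_integral_mul_le (ν := μ) (f := fun x => (starRingEnd ℂ) (F (Φ x))) (g := u)
    (Complex.continuous_conj.comp_aestronglyMeasurable hF') (k := fun x => k (Φ x))
    (fun x => hk _) (hkm.comp hΦ)
  rw [← hpair (fun z => (starRingEnd ℂ) (F z)) hF.star, ← hN] at h2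
  have h3 : ∫⁻ x, ENNReal.ofReal (k (Φ x))⁻¹ * ‖(starRingEnd ℂ) (F (Φ x))‖ₑ ^ 2 ∂μ ≤
      ∫⁻ z, ‖F z‖ₑ ^ 2 ∂ν := by
    have hac : μ.map Φ ≪ ν := (Measure.absolutelyContinuous_of_le hle).trans
      (withDensity_absolutelyContinuous _ _)
    have hm : AEMeasurable (fun z => ENNReal.ofReal (k z)⁻¹ * ‖F z‖ₑ ^ 2) ν := by
      have := hF.1
      fun_prop
    calc _ = ∫⁻ x, (fun z => ENNReal.ofReal (k z)⁻¹ * ‖F z‖ₑ ^ 2) (Φ x) ∂μ := by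
          refine lintegral_congr fun x => ?_
          rw [RCLike.enorm_conj]
      _ = ∫⁻ z, ENNReal.ofReal (k z)⁻¹ * ‖F z‖ₑ ^ 2 ∂(μ.map Φ) :=
          (lintegral_map' (hm.mono_ac hac) hΦ.aemeasurable).symm
      _ ≤ ∫⁻ z, ENNReal.ofReal (k z)⁻¹ * ‖F z‖ₑ ^ 2
            ∂(ν.withDensity fun z => ENNReal.ofReal (k z)) := lintegral_mono' hle le_rfl
      _ = ∫⁻ z, ‖F z‖ₑ ^ 2 ∂ν := by
          rw [lintegral_withDensity_eq_lintegral_mul₀ (by fun_prop) hm]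
          refine lintegral_congr fun z => ?_
          rw [Pi.mul_apply, ← mul_assoc, ← ENNReal.ofReal_mul (hk z).le,
            mul_inv_cancel₀ (hk z).ne', ENNReal.ofReal_one, one_mul]
  rw [two_mul] at h2
  exact (ENNReal.add_le_add_iff_left hfin).1 (h2.trans (add_le_add_left h3 _))

end Duality

/-! ### The density of the convolution of the surface measure -/

/-- The pair `(y, y')` is mapped to the sum of the points of the surface above `y` and `y'`. -/
noncomputable def pairMap (φ : Plane → ℝ) (z : Plane × Plane) : Plane × ℝ :=
  (z.1 + z.2, phase φ z.1 + phase φ z.2)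

section PairMap

variable {φ : Plane → ℝ}

theorem continuous_pairMap (hφ : Continuous φ) : Continuous (pairMap φ) := by
  have := continuous_phase hφ
  unfold pairMap; fun_prop

/-- The substitution `y = ξ / 2 + w`, `y' = ξ / 2 - w` has unit Jacobian; it is carried out by
translations and an exchange of integrals. -/
theorem lintegral_pairMap (hφ : Continuous φ) {G : Plane × ℝ → ENNReal} (hG : Measurable G) :
    ∫⁻ z, G (pairMap φ z) = ∫⁻ ξ : Plane, ∫⁻ w, G (ξ, pairPhase φ ((1 / 2 : ℝ) • ξ) w) := by
  have hm : Measurable fun z => G (pairMap φ z) := hG.comp (continuous_pairMap hφ).measurable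
  rw [Measure.volume_eq_prod, lintegral_prod _ hm.aemeasurable]
  calc ∫⁻ y, ∫⁻ y', G (pairMap φ (y, y')) = ∫⁻ y, ∫⁻ ξ, G (pairMap φ (y, ξ - y)) := by
        refine lintegral_congr fun y => ?_
        exact (lintegral_sub_right_eq_self (fun y' => G (pairMap φ (y, y'))) y).symm
    _ = ∫⁻ ξ, ∫⁻ y, G (pairMap φ (y, ξ - y)) := by
        refine lintegral_lintegral_swap (Measurable.aemeasurable ?_)
        exact hm.comp (f := fun p : Plane × Plane => (p.1, p.2 - p.1)) (by fun_prop)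
    _ = _ := by
        refine lintegral_congr fun ξ => ?_
        rw [← lintegral_add_left_eq_self (fun y => G (pairMap φ (y, ξ - y))) ((1 / 2 : ℝ) • ξ)]
        refine lintegral_congr fun w => ?_
        have h2 : ξ - ((1 / 2 : ℝ) • ξ + w) = (1 / 2 : ℝ) • ξ - w := by
          module
        simp only [pairMap, h2, pairPhase]
        congr 2
        module

theorem map_pairMap_le (hφ : ContDiff ℝ 2 φ) (hc : ConvexOn ℝ Set.univ φ) :
    (volume : Measure (Plane × Plane)).map (pairMap φ) ≤
      ENNReal.ofReal (Real.pi / 2) • (volume : Measure (Plane × ℝ)) := by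
  have hmeas := (continuous_pairMap hφ.continuous).measurable
  refine Measure.le_iff.2 fun A hA => ?_
  have hG : Measurable (A.indicator (1 : Plane × ℝ → ENNReal)) := measurable_one.indicator hA
  rw [← lintegral_indicator_one hA, lintegral_map hG hmeas, lintegral_pairMap hφ.continuous hG,
    Measure.smul_apply, ← lintegral_indicator_one hA, smul_eq_mul, Measure.volume_eq_prod,
    lintegral_prod _ hG.aemeasurable, ← lintegral_const_mul _ hG.lintegral_prod_right']
  refine lintegral_mono fun ξ => ?_
  -- The empty sector: only the convexity bound `1 / 4` per direction is used.
  have := lintegral_pairPhase_le hφ hc ((1 / 2 : ℝ) • ξ) (α := 0) (β := 0) (c := 0)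
    (by linarith [Real.pi_pos]) le_rfl Real.pi_pos.le le_rfl (hG.comp measurable_prodMk_left)
    (p := fun t => A.indicator (1 : Plane × ℝ → ENNReal) (ξ, t)) (by simp)
  simpa using this

/-- The density of `σ ∗ σ` is below `π / 2`, uniformly on bounded sets. -/
theorem exists_map_pairMap_le_withDensity (hφ : ContDiff ℝ 2 φ) (hc : ConvexOn ℝ Set.univ φ)
    (hφ0 : ∀ y, 0 ≤ φ y) (hH : ∀ y, hessian φ y ≠ 0) (ρ : ℝ) :
    ∃ δ : ℝ, 0 < δ ∧ ∃ k : Plane × ℝ → ℝ, Measurable k ∧ (∀ z, 0 < k z) ∧ (∀ z, k z ≤ Real.pi / 2) ∧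
      (∀ y y' : Plane, ‖y‖ ≤ ρ → ‖y'‖ ≤ ρ → k (pairMap φ (y, y')) ≤ Real.pi / 2 - δ) ∧
      (volume : Measure (Plane × Plane)).map (pairMap φ) ≤
        (volume : Measure (Plane × ℝ)).withDensity fun z => ENNReal.ofReal (k z) := by
  obtain ⟨T, hT⟩ := (isCompact_closedBall (0 : Plane) ρ).bddAbove_image
    (continuous_phase hφ.continuous).continuousOn
  obtain ⟨δ', hδ', hle⟩ := exists_lintegral_pairPhase_le hφ hc hφ0 hH
    (isCompact_closedBall (0 : Plane) ρ) (T + T)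
  -- The cap `δ ≤ 1` keeps `π / 2 - δ` positive, as the weight `k` must be.
  set δ := min δ' 1
  have hδ : 0 < δ := lt_min hδ' one_pos
  have hδ1 : δ ≤ 1 := min_le_right _ _
  -- `S` contains every sum of two surface points over the ball, and its midpoints `ξ / 2` stay in
  -- that same ball.
  set S : Set (Plane × ℝ) := {z | ‖z.1‖ ≤ 2 * ρ ∧ z.2 ≤ T + T}
  have hS : MeasurableSet S := by
    exact (measurableSet_le (f := fun z : Plane × ℝ => ‖z.1‖) (by fun_prop) (by fun_prop)).inter
      (measurableSet_le (f := fun z : Plane × ℝ => z.2) (by fun_prop) (by fun_prop))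
  have hpi := Real.pi_gt_three
  set k : Plane × ℝ → ℝ := fun z => Real.pi / 2 - S.indicator (fun _ => δ) z with hk
  have hkS : ∀ z ∈ S, k z = Real.pi / 2 - δ := fun z hz => by simp [hk, hz]
  have hkS' : ∀ z ∉ S, k z = Real.pi / 2 := fun z hz => by simp [hk, hz]
  refine ⟨δ, hδ, k, ?_, ?_, ?_, ?_, ?_⟩
  · exact measurable_const.sub (measurable_const.indicator hS)
  · intro z
    by_cases hz : z ∈ S
    · rw [hkS z hz]; linarith
    · rw [hkS' z hz]; linarith
  · intro z
    by_cases hz : z ∈ S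
    · rw [hkS z hz]; linarith
    · rw [hkS' z hz]
  · intro y y' hy hy'
    refine (hkS _ ⟨?_, ?_⟩).le
    · exact (norm_add_le y y').trans (by linarith)
    · exact add_le_add (hT ⟨y, by simpa using hy, rfl⟩) (hT ⟨y', by simpa using hy', rfl⟩)
  have hmeas := (continuous_pairMap hφ.continuous).measurable
  refine Measure.le_iff.2 fun A hA => ?_
  rw [withDensity_apply _ hA, ← measure_inter_add_sdiff A hS,
    ← lintegral_inter_add_sdiff _ _ hS]
  refine add_le_add ?_ ?_
  · have hAS := hA.inter hS
    have hG : Measurable ((A ∩ S).indicator (1 : Plane × ℝ → ENNReal)) :=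
      measurable_one.indicator hAS
    rw [setLIntegral_congr_fun hAS (g := fun _ => ENNReal.ofReal (Real.pi / 2 - δ))
      (fun z hz => by rw [hkS z hz.2]), setLIntegral_const, ← lintegral_indicator_one hAS,
      lintegral_map hG hmeas, lintegral_pairMap hφ.continuous hG, ← lintegral_indicator_one hAS,
      Measure.volume_eq_prod, lintegral_prod _ hG.aemeasurable,
      ← lintegral_const_mul _ hG.lintegral_prod_right']
    refine lintegral_mono fun ξ => ?_
    by_cases hξ : ‖ξ‖ ≤ 2 * ρ
    · refine (hle ((1 / 2 : ℝ) • ξ) ?_ _ (hG.comp measurable_prodMk_left) fun t ht => ?_).trans ?_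
      · rw [mem_closedBall_zero_iff, norm_smul, Real.norm_of_nonneg (by norm_num)]
        linarith
      · exact Set.indicator_of_notMem (fun h => absurd h.2.2 (not_le.2 ht)) _
      · change ENNReal.ofReal (Real.pi / 2 - δ') * _ ≤ _
        refine mul_le_mul' (ENNReal.ofReal_le_ofReal ?_) le_rfl
        linarith [min_le_left δ' 1]
    · have h0 : ∀ t, (A ∩ S).indicator (1 : Plane × ℝ → ENNReal) (ξ, t) = 0 := fun t =>
        Set.indicator_of_notMem (fun h => hξ h.2.1) _
      simp [h0]
  · rw [setLIntegral_congr_fun (hA.diff hS) (g := fun _ => ENNReal.ofReal (Real.pi / 2))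
      (fun z hz => by rw [hkS' z hz.2]), setLIntegral_const]
    exact map_pairMap_le hφ hc _

end PairMap

/-! ### The convolution inequality with a gain -/

theorem eLpNorm_two_sq {α : Type*} [MeasurableSpace α] {μ : Measure α} (F : α → ℂ) :
    eLpNorm F 2 μ ^ 2 = ∫⁻ z, ‖F z‖ₑ ^ 2 ∂μ := by
  have := eLpNorm_nnreal_pow_eq_lintegral (μ := μ) (f := F) (p := 2) two_ne_zero
  simpa using this

theorem memLp_tensor {f : Plane → ℂ} (hf : MemLp f 2 volume) :
    MemLp (fun z : Plane × Plane => f z.1 * f z.2) 2 volume := by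
  have hm : AEStronglyMeasurable (fun z : Plane × Plane => f z.1 * f z.2) volume :=
    hf.1.comp_fst.mul hf.1.comp_snd
  rw [memLp_two_iff_integrable_sq_norm hm]
  have h := (memLp_two_iff_integrable_sq_norm hf.1).1 hf
  simp only [norm_mul, mul_pow]
  exact h.mul_prod h

theorem lintegral_tensor {a : Plane → ENNReal} (ha : AEMeasurable a volume) :
    ∫⁻ z : Plane × Plane, a z.1 * a z.2 = (∫⁻ y, a y) ^ 2 := by
  rw [Measure.volume_eq_prod, lintegral_prod_mul ha ha, sq]

section ConvDensity

variable {φ : Plane → ℝ}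

theorem integral_projMeasure_prod (hφ : Continuous φ) {f : Plane → ℂ} (hf : StronglyMeasurable f)
    {g : Plane × ℝ → ℝ} (hg : Continuous g) :
    ∫ pq : (Plane × ℝ) × (Plane × ℝ), g (pq.1 + pq.2) • (f pq.1.1 * f pq.2.1)
        ∂((projMeasure φ).prod (projMeasure φ)) =
      ∫ z : Plane × Plane, (g (pairMap φ z) : ℂ) * (f z.1 * f z.2) := by
  have hP : Measurable fun y : Plane => (y, ‖y‖ ^ 2 + φ y) := by
    have := hφ.measurable
    fun_prop
  have hm : StronglyMeasurable fun pq : (Plane × ℝ) × (Plane × ℝ) =>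
      g (pq.1 + pq.2) • (f pq.1.1 * f pq.2.1) := by
    refine StronglyMeasurable.smul (hg.comp (by fun_prop)).stronglyMeasurable
      (StronglyMeasurable.mul ?_ ?_)
    · exact hf.comp_measurable (by fun_prop)
    · exact hf.comp_measurable (by fun_prop)
  rw [projMeasure, Measure.map_prod_map _ _ hP hP,
    integral_map (hP.prodMap hP).aemeasurable hm.aestronglyMeasurable]
  refine integral_congr_ae (ae_of_all _ fun z => ?_)
  simp [pairMap, phase]

/-- For `f ∈ L²` the convolution `fσ ∗ fσ` has a square integrable density, and its pairing formula
extends to all square integrable functions. -/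
theorem exists_isConvDensity (hφ : ContDiff ℝ 2 φ) (hc : ConvexOn ℝ Set.univ φ)
    (f : Lp ℂ 2 (volume : Measure Plane)) :
    ∃ F : Plane × ℝ → ℂ, MemLp F 2 volume ∧ IsConvDensity φ f F ∧
      ∀ g : Plane × ℝ → ℂ, MemLp g 2 volume →
        ∫ z, g z * F z = ∫ z : Plane × Plane, g (pairMap φ z) * (f z.1 * f z.2) := by
  obtain ⟨F, hF, hpair⟩ := exists_memLp_density (continuous_pairMap hφ.continuous).measurable
    ENNReal.ofReal_ne_top (map_pairMap_le hφ hc) (memLp_tensor (Lp.memLp f))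
  refine ⟨F, hF, ⟨hF.locallyIntegrable (by norm_num), fun g hg hgc => ?_⟩, hpair⟩
  rw [integral_projMeasure_prod hφ.continuous (Lp.stronglyMeasurable f) hg]
  have hgc' : HasCompactSupport fun z => (g z : ℂ) := hgc.comp_left Complex.ofReal_zero
  rw [← hpair (fun z => (g z : ℂ))
    ((Complex.continuous_ofReal.comp hg).memLp_of_hasCompactSupport hgc')]
  simp

/-- This is `lintegral_density_le` for the tensor square of `f`. Keeping `k` under the integral,
rather than its supremum, allows a gain from mass in a ball. -/
theorem convNorm_sq_le (hφ : ContDiff ℝ 2 φ) (hc : ConvexOn ℝ Set.univ φ)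
    {k : Plane × ℝ → ℝ} (hk : ∀ z, 0 < k z) (hkm : Measurable k)
    (hle : (volume : Measure (Plane × Plane)).map (pairMap φ) ≤
      (volume : Measure (Plane × ℝ)).withDensity fun z => ENNReal.ofReal (k z))
    (f : Lp ℂ 2 (volume : Measure Plane)) :
    convNorm φ f ^ 2 ≤ ∫⁻ z : Plane × Plane,
      ENNReal.ofReal (k (pairMap φ z)) * (‖f z.1‖ₑ ^ 2 * ‖f z.2‖ₑ ^ 2) := by
  obtain ⟨F, hF, hFd, hpair⟩ := exists_isConvDensity hφ hc f
  have hmeas := (continuous_pairMap hφ.continuous).measurable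
  rw [hFd.convNorm_eq, eLpNorm_two_sq]
  have := lintegral_density_le hmeas hk hkm hle hF
    (MemLp.comp_of_map_le hmeas ENNReal.ofReal_ne_top (map_pairMap_le hφ hc) hF).1 hpair
  simpa only [enorm_mul, mul_pow] using this

/-- The convolution inequality with a gain from the mass of `f` in a ball. -/
theorem exists_convNorm_sq_add_le (hφ : ContDiff ℝ 2 φ) (hc : ConvexOn ℝ Set.univ φ)
    (hφ0 : ∀ y, 0 ≤ φ y) (hH : ∀ y, hessian φ y ≠ 0) (ρ : ℝ) :
    ∃ δ : ℝ, 0 < δ ∧ ∀ f : Lp ℂ 2 (volume : Measure Plane),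
      convNorm φ f ^ 2 + ENNReal.ofReal δ * (∫⁻ y in {y : Plane | ‖y‖ ≤ ρ}, ‖f y‖ₑ ^ 2) ^ 2 ≤
        ENNReal.ofReal (Real.pi / 2) * (∫⁻ y, ‖f y‖ₑ ^ 2) ^ 2 := by
  obtain ⟨δ, hδ, k, hkm, hk, hkpi, hkδ, hle⟩ :=
    exists_map_pairMap_le_withDensity hφ hc hφ0 hH ρ
  refine ⟨δ, hδ, fun f => ?_⟩
  have hB : MeasurableSet {y : Plane | ‖y‖ ≤ ρ} := measurableSet_le (by fun_prop) (by fun_prop)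
  have hfm := (Lp.stronglyMeasurable f).measurable
  have hmeas := (continuous_pairMap hφ.continuous).measurable
  have ha : Measurable fun y => ‖f y‖ₑ ^ 2 := by fun_prop
  have hb := ha.indicator hB
  rw [← lintegral_indicator hB, ← lintegral_tensor ha.aemeasurable,
    ← lintegral_tensor hb.aemeasurable, ← lintegral_const_mul' _ _ ENNReal.ofReal_ne_top,
    ← lintegral_const_mul' _ _ ENNReal.ofReal_ne_top]
  refine (add_le_add_left (convNorm_sq_le hφ hc hk hkm hle f) _).trans ?_
  rw [← lintegral_add_left (by fun_prop)]
  refine lintegral_mono fun z => ?_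
  dsimp only
  -- The added term lives where both points are in the ball, and there `k + δ ≤ π / 2`.
  by_cases h : ‖z.1‖ ≤ ρ ∧ ‖z.2‖ ≤ ρ
  · rw [Set.indicator_of_mem (show z.1 ∈ {y : Plane | ‖y‖ ≤ ρ} from h.1),
      Set.indicator_of_mem (show z.2 ∈ {y : Plane | ‖y‖ ≤ ρ} from h.2), ← add_mul,
      ← ENNReal.ofReal_add (hk _).le hδ.le]
    gcongr
    linarith [hkδ z.1 z.2 h.1 h.2]
  · have h0 : {y : Plane | ‖y‖ ≤ ρ}.indicator (fun y => ‖f y‖ₑ ^ 2) z.1 *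
        {y : Plane | ‖y‖ ≤ ρ}.indicator (fun y => ‖f y‖ₑ ^ 2) z.2 = 0 := by
      rcases not_and_or.1 h with h | h
      · rw [Set.indicator_of_notMem (by exact h), zero_mul]
      · rw [Set.indicator_of_notMem (a := z.2) (by exact h), mul_zero]
    rw [h0, mul_zero, add_zero]
    gcongr
    exact hkpi _

end ConvDensity

/-! ### Lower bound for the density near a point with small Hessian -/

section LowerBound

variable {φ : Plane → ℝ}

theorem unitVec_eq (θ : ℝ) : unitVec θ = Real.cos θ • EuclideanSpace.single 0 1 +
    Real.sin θ • EuclideanSpace.single 1 1 := by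
  ext i; fin_cases i <;> simp [unitVec]

/-- The `ℓ¹` norm of the Hessian matrix. -/
noncomputable def hessianSum (φ : Plane → ℝ) (x : Plane) : ℝ :=
  |hessian φ x 0 0| + |hessian φ x 0 1| + (|hessian φ x 1 0| + |hessian φ x 1 1|)

theorem continuous_hessianSum (hφ : ContDiff ℝ 2 φ) : Continuous (hessianSum φ) := by
  have h2 : ContDiff ℝ 1 (fderiv ℝ φ) := hφ.fderiv_right (by norm_num)
  have hcont : Continuous (fderiv ℝ (fderiv ℝ φ)) := h2.continuous_fderiv (by norm_num)
  unfold hessianSum hessian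
  simp only [Matrix.of_apply]
  fun_prop

theorem fderiv_fderiv_unitVec_le (φ : Plane → ℝ) (x : Plane) (θ : ℝ) :
    fderiv ℝ (fderiv ℝ φ) x (unitVec θ) (unitVec θ) ≤ hessianSum φ x := by
  have hexp : fderiv ℝ (fderiv ℝ φ) x (unitVec θ) (unitVec θ) =
      (Real.cos θ * Real.cos θ) * hessian φ x 0 0 + (Real.cos θ * Real.sin θ) * hessian φ x 0 1 +
      ((Real.sin θ * Real.cos θ) * hessian φ x 1 0 +
        (Real.sin θ * Real.sin θ) * hessian φ x 1 1) := by
    rw [unitVec_eq]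
    simp only [map_add, map_smul, add_apply, smul_apply, smul_eq_mul, hessian, Matrix.of_apply]
    ring
  have hle : ∀ a b h : ℝ, |a| ≤ 1 → |b| ≤ 1 → a * b * h ≤ |h| := fun a b h ha hb => by
    refine (le_abs_self _).trans ?_
    rw [abs_mul, abs_mul]
    exact mul_le_of_le_one_left (abs_nonneg _) (mul_le_one₀ ha (abs_nonneg _) hb)
  have hcos := Real.abs_cos_le_one θ
  have hsin := Real.abs_sin_le_one θ
  rw [hexp]
  exact add_le_add (add_le_add (hle _ _ _ hcos hcos) (hle _ _ _ hcos hsin))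
    (add_le_add (hle _ _ _ hsin hcos) (hle _ _ _ hsin hsin))

/-- If the Hessian tends to zero along a sequence, the second derivative is small on some ball. -/
theorem exists_ball_hessian_le (hφ : ContDiff ℝ 2 φ) {y : ℕ → Plane}
    (hy : Tendsto (fun n => hessian φ (y n)) atTop (𝓝 0)) {c : ℝ} (hc : 0 < c) :
    ∃ (y₀ : Plane) (r : ℝ), 0 < r ∧ ∀ x, dist x y₀ < r → ∀ θ,
      fderiv ℝ (fderiv ℝ φ) x (unitVec θ) (unitVec θ) ≤ c := by
  have hent : ∀ i j : Fin 2, Tendsto (fun n => |hessian φ (y n) i j|) atTop (𝓝 0) := fun i j => by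
    have := (tendsto_pi_nhds.1 (tendsto_pi_nhds.1 hy i) j).abs
    simpa using this
  have hsum : Tendsto (fun n => hessianSum φ (y n)) atTop (𝓝 0) := by
    simpa [hessianSum] using ((hent 0 0).add (hent 0 1)).add ((hent 1 0).add (hent 1 1))
  obtain ⟨n, hn⟩ := (hsum.eventually_lt_const hc).exists
  obtain ⟨r, hr, hball⟩ := Metric.eventually_nhds_iff.1
    (((continuous_hessianSum hφ).tendsto (y n)).eventually_lt_const hn)
  exact ⟨y n, r, hr, fun x hx θ => (fderiv_fderiv_unitVec_le φ x θ).trans (hball hx).le⟩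

/-- The height of `phase φ` above its tangent plane at `y₀`. -/
noncomputable def tangentHeight (φ : Plane → ℝ) (y₀ y : Plane) : ℝ :=
  ‖y - y₀‖ ^ 2 + (φ y - φ y₀ - fderiv ℝ φ y₀ (y - y₀))

/-- The affine function measuring the height above twice the tangent point. -/
noncomputable def sumHeight (φ : Plane → ℝ) (y₀ : Plane) (z : Plane × ℝ) : ℝ :=
  z.2 - 2 * inner ℝ z.1 y₀ + 2 * ‖y₀‖ ^ 2 - 2 * φ y₀ - fderiv ℝ φ y₀ (z.1 - (y₀ + y₀))

/-- `‖y - y₀‖²` differs from `‖y‖²` by an affine function, so a sum of tangent heights depends only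
on the sum of the two surface points. Exponentials of `tangentHeight` thus have tensor squares that
factor through `pairMap`, as equality in Cauchy–Schwarz demands. -/
theorem sumHeight_pairMap (y₀ : Plane) (z : Plane × Plane) :
    sumHeight φ y₀ (pairMap φ z) = tangentHeight φ y₀ z.1 + tangentHeight φ y₀ z.2 := by
  have h : z.1 + z.2 - (y₀ + y₀) = (z.1 - y₀) + (z.2 - y₀) := by abel
  simp only [sumHeight, pairMap, tangentHeight, phase, h, map_add, norm_sub_sq_real,
    inner_add_left]
  ring

theorem continuous_sumHeight (y₀ : Plane) : Continuous (sumHeight φ y₀) := by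
  unfold sumHeight
  fun_prop

/-- A convex function lies above its tangent plane. Low heights therefore confine points to small
balls about `y₀`. -/
theorem norm_sq_le_tangentHeight (hφ : ContDiff ℝ 2 φ) (hc : ConvexOn ℝ Set.univ φ)
    (y₀ y : Plane) : ‖y - y₀‖ ^ 2 ≤ tangentHeight φ y₀ y := by
  have h1 := (convex_Icc (0 : ℝ) 1).mul_sub_le_image_sub_of_le_deriv
    (f := fun t : ℝ => φ (y₀ + t • (y - y₀))) (C := fderiv ℝ φ y₀ (y - y₀))
    (fun t _ => (hasDerivAt_line hφ y₀ _ t).continuousAt.continuousWithinAt)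
    (fun t _ => (hasDerivAt_line hφ y₀ _ t).differentiableAt.differentiableWithinAt)
    (fun t ht => by
      rw [interior_Icc] at ht
      rw [(hasDerivAt_line hφ y₀ _ t).deriv]
      simpa using monotone_fderiv_line hφ hc y₀ (y - y₀) ht.1.le)
    0 (by simp) 1 (by simp) zero_le_one
  simp only [one_smul, zero_smul, add_zero, sub_zero, mul_one, add_sub_cancel] at h1
  unfold tangentHeight
  linarith

/-- Midpoint convexity. Below this level there are no sums of surface points, so a lower bound for
the density needs test functions supported above it. -/
theorem pairPhase_zero_le (hc : ConvexOn ℝ Set.univ φ) (x w : Plane) :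
    pairPhase φ x 0 ≤ pairPhase φ x w := by
  have h := hc.2 (Set.mem_univ (x + w)) (Set.mem_univ (x - w)) (by norm_num : (0 : ℝ) ≤ 1 / 2)
    (by norm_num : (0 : ℝ) ≤ 1 / 2) (by norm_num)
  have h2 : (1 / 2 : ℝ) • (x + w) + (1 / 2 : ℝ) • (x - w) = x := by module
  rw [h2, smul_eq_mul, smul_eq_mul] at h
  rw [pairPhase_eq, pairPhase_eq]
  simp only [norm_zero, add_zero, sub_zero]
  nlinarith [sq_nonneg ‖w‖]

/-- The part of the sumset of the surface lying close to twice the point above `y₀`. -/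
def sumCap (φ : Plane → ℝ) (y₀ : Plane) (s : ℝ) : Set (Plane × ℝ) :=
  {z | pairPhase φ ((1 / 2 : ℝ) • z.1) 0 ≤ z.2 ∧ sumHeight φ y₀ z ≤ s}

theorem measurableSet_sumCap (hφ : Continuous φ) (y₀ : Plane) (s : ℝ) :
    MeasurableSet (sumCap φ y₀ s) := by
  have h1 : Continuous fun z : Plane × ℝ => pairPhase φ ((1 / 2 : ℝ) • z.1) 0 := by
    have := continuous_phase hφ
    unfold pairPhase
    fun_prop
  exact (measurableSet_le h1.measurable (by fun_prop)).inter
    (measurableSet_le (continuous_sumHeight y₀).measurable (by fun_prop))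

theorem pairMap_mem_sumCap_iff (hc : ConvexOn ℝ Set.univ φ) (y₀ : Plane) (s : ℝ)
    (z : Plane × Plane) :
    pairMap φ z ∈ sumCap φ y₀ s ↔ sumHeight φ y₀ (pairMap φ z) ≤ s := by
  refine and_iff_right ?_
  have h := pairPhase_zero_le hc ((1 / 2 : ℝ) • (z.1 + z.2)) ((1 / 2 : ℝ) • (z.1 - z.2))
  have h1 : (1 / 2 : ℝ) • (z.1 + z.2) + (1 / 2 : ℝ) • (z.1 - z.2) = z.1 := by module
  have h2 : (1 / 2 : ℝ) • (z.1 + z.2) - (1 / 2 : ℝ) • (z.1 - z.2) = z.2 := by module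
  refine h.trans_eq ?_
  rw [pairPhase, h1, h2]
  rfl

theorem dist_le_of_sumHeight_le (hφ : ContDiff ℝ 2 φ) (hc : ConvexOn ℝ Set.univ φ) {y₀ : Plane}
    {r : ℝ} (hr : 0 ≤ r) {z : Plane × Plane} (hz : sumHeight φ y₀ (pairMap φ z) ≤ r ^ 2) :
    dist z.1 y₀ ≤ r ∧ dist z.2 y₀ ≤ r := by
  rw [sumHeight_pairMap] at hz
  have h1 := norm_sq_le_tangentHeight hφ hc y₀ z.1
  have h2 := norm_sq_le_tangentHeight hφ hc y₀ z.2
  rw [dist_eq_norm, dist_eq_norm]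
  constructor
  · exact abs_le_of_sq_le_sq' (by nlinarith [sq_nonneg ‖z.2 - y₀‖]) hr |>.2
  · exact abs_le_of_sq_le_sq' (by nlinarith [sq_nonneg ‖z.1 - y₀‖]) hr |>.2

/-- Lower bound for the density of `σ ∗ σ` near twice a point where the Hessian is small. -/
theorem mul_lintegral_le_lintegral_pairMap (hφ : ContDiff ℝ 2 φ) (hc : ConvexOn ℝ Set.univ φ)
    (hφ0 : ∀ y, 0 ≤ φ y) {y₀ : Plane} {r c : ℝ} (hr : 0 < r) (hc0 : 0 < c)
    (hball : ∀ x, dist x y₀ < r → ∀ θ, fderiv ℝ (fderiv ℝ φ) x (unitVec θ) (unitVec θ) ≤ c)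
    {G : Plane × ℝ → ENNReal} (hG : Measurable G)
    (hsupp : ∀ z ∉ sumCap φ y₀ ((r / 2) ^ 2), G z = 0) :
    ENNReal.ofReal (2 * Real.pi * (4 + 2 * c)⁻¹) * ∫⁻ z, G z ≤
      ∫⁻ z : Plane × Plane, G (pairMap φ z) := by
  rw [lintegral_pairMap hφ.continuous hG, Measure.volume_eq_prod, lintegral_prod _ hG.aemeasurable,
    ← lintegral_const_mul' _ _ ENNReal.ofReal_ne_top]
  refine lintegral_mono fun ξ => ?_
  -- The constant doubles because `gradGap` accumulates the second derivative at two symmetric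
  -- points.
  refine le_lintegral_pairPhase hφ hc hφ0 ((1 / 2 : ℝ) • ξ) (c := 2 * c) (by linarith)
    (p := fun t => G (ξ, t)) (hG.comp measurable_prodMk_left) (fun t ht => ?_) fun θ ρ hρ => ?_
  · exact hsupp _ fun h => absurd h.1 (not_le.2 ht)
  by_cases hmem : (ξ, pairPhase φ ((1 / 2 : ℝ) • ξ) (ρ • unitVec θ)) ∈ sumCap φ y₀ ((r / 2) ^ 2)
  swap
  · exact Or.inl (hsupp _ hmem)
  right
  set x := (1 / 2 : ℝ) • ξ with hx
  have hξ : (ξ, pairPhase φ x (ρ • unitVec θ)) =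
      pairMap φ (x + ρ • unitVec θ, x - ρ • unitVec θ) := by
    simp only [pairMap, pairPhase, Prod.mk.injEq, and_true, hx]
    module
  have hd := dist_le_of_sumHeight_le hφ hc (by positivity) (hξ ▸ hmem.2)
  refine gradGap_le_mul hφ x _ hρ.le fun t ht => hball _ ?_ θ
  -- Both endpoints `x ± ρ e` lie in the ball of radius `r / 2`, hence so does the segment between
  -- them.
  have hseg : x + t • unitVec θ ∈ Metric.closedBall y₀ (r / 2) := by
    have hconv := (convex_closedBall y₀ (r / 2)) (Metric.mem_closedBall.2 hd.1)
      (Metric.mem_closedBall.2 hd.2) (a := (1 + t / ρ) / 2) (b := (1 - t / ρ) / 2) ?_ ?_ (by ring)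
    · convert hconv using 1
      have h1 : t = (t / ρ) * ρ := by field_simp
      dsimp only
      conv_lhs => rw [h1]
      module
    · have := (abs_le.1 ht).1
      have : -1 ≤ t / ρ := by rw [le_div_iff₀ hρ]; linarith
      linarith
    · have : t / ρ ≤ 1 := by rw [div_le_one hρ]; exact (abs_le.1 ht).2
      linarith
  exact (Metric.mem_closedBall.1 hseg).trans_lt (by linarith)

end LowerBound

/-! ### Exponential test functions -/

section Extremizers

variable {φ : Plane → ℝ}

/-- The exponential of the tangent height, cut off to a ball about the tangent point. -/
noncomputable def expBump (φ : Plane → ℝ) (y₀ : Plane) (r a : ℝ) : Plane → ℝ :=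
  (Metric.closedBall y₀ r).indicator fun y => Real.exp (-a * tangentHeight φ y₀ y)

theorem continuous_tangentHeight (hφ : Continuous φ) (y₀ : Plane) :
    Continuous (tangentHeight φ y₀) := by
  unfold tangentHeight
  fun_prop

theorem measurable_expBump (hφ : Continuous φ) (y₀ : Plane) (r a : ℝ) :
    Measurable (expBump φ y₀ r a) := by
  have := (continuous_tangentHeight hφ y₀).measurable
  exact Measurable.indicator (by fun_prop) measurableSet_closedBall

theorem expBump_nonneg (y₀ : Plane) (r a : ℝ) (y : Plane) : 0 ≤ expBump φ y₀ r a y :=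
  Set.indicator_nonneg (fun _ _ => (Real.exp_pos _).le) _

theorem expBump_le_indicator (hφ : ContDiff ℝ 2 φ) (hc : ConvexOn ℝ Set.univ φ) (y₀ : Plane)
    {r a : ℝ} (ha : 0 ≤ a) (y : Plane) :
    expBump φ y₀ r a y ≤ (Metric.closedBall y₀ r).indicator 1 y := by
  refine Set.indicator_le_indicator ?_
  have := (sq_nonneg ‖y - y₀‖).trans (norm_sq_le_tangentHeight hφ hc y₀ y)
  exact Real.exp_le_one_iff.2 (by nlinarith)

theorem memLp_expBump (hφ : ContDiff ℝ 2 φ) (hc : ConvexOn ℝ Set.univ φ) (y₀ : Plane)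
    (r : ℝ) {a : ℝ} (ha : 0 ≤ a) :
    MemLp (fun y => (expBump φ y₀ r a y : ℂ)) 2 volume := by
  have h1 : MemLp ((Metric.closedBall y₀ r).indicator fun _ : Plane => (1 : ℝ)) 2 volume :=
    memLp_indicator_const 2 measurableSet_closedBall 1 (Or.inr measure_closedBall_lt_top.ne)
  refine h1.mono (Complex.measurable_ofReal.comp
    (measurable_expBump hφ.continuous y₀ r a)).aestronglyMeasurable (ae_of_all _ fun y => ?_)
  rw [Complex.norm_real, Real.norm_of_nonneg (expBump_nonneg _ _ _ _)]
  exact (expBump_le_indicator hφ hc y₀ ha y).trans (le_abs_self _)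

/-- The test function dual to the convolution of `expBump` with itself. -/
noncomputable def expCap (φ : Plane → ℝ) (y₀ : Plane) (s a : ℝ) : Plane × ℝ → ℝ :=
  (sumCap φ y₀ s).indicator fun z => Real.exp (-a * sumHeight φ y₀ z)

theorem measurable_expCap (hφ : Continuous φ) (y₀ : Plane) (s a : ℝ) :
    Measurable (expCap φ y₀ s a) := by
  have := (continuous_sumHeight (φ := φ) y₀).measurable
  exact Measurable.indicator (by fun_prop) (measurableSet_sumCap hφ y₀ s)

theorem expBump_mul_expBump (hφ : ContDiff ℝ 2 φ) (hc : ConvexOn ℝ Set.univ φ) (y₀ : Plane)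
    {r : ℝ} (hr : 0 < r) (a : ℝ) {z : Plane × Plane}
    (hz : sumHeight φ y₀ (pairMap φ z) ≤ (r / 2) ^ 2) :
    expBump φ y₀ r a z.1 * expBump φ y₀ r a z.2 =
      Real.exp (-a * sumHeight φ y₀ (pairMap φ z)) := by
  have hd := dist_le_of_sumHeight_le hφ hc (by positivity) hz
  rw [expBump, Set.indicator_of_mem (Metric.mem_closedBall.2 (by linarith [hd.1])),
    Set.indicator_of_mem (Metric.mem_closedBall.2 (by linarith [hd.2])), ← Real.exp_add,
    sumHeight_pairMap]
  ring_nf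

/-- On the cap both points lie where the bump is not cut off; off the cap both sides vanish. Pairing
the convolution with `expCap` thus produces a square. -/
theorem expCap_mul_expBump (hφ : ContDiff ℝ 2 φ) (hc : ConvexOn ℝ Set.univ φ) (y₀ : Plane)
    {r : ℝ} (hr : 0 < r) (a : ℝ) (z : Plane × Plane) :
    expCap φ y₀ ((r / 2) ^ 2) a (pairMap φ z) *
        (expBump φ y₀ r a z.1 * expBump φ y₀ r a z.2) =
      expCap φ y₀ ((r / 2) ^ 2) a (pairMap φ z) ^ 2 := by
  by_cases hz : pairMap φ z ∈ sumCap φ y₀ ((r / 2) ^ 2)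
  · have h : expCap φ y₀ ((r / 2) ^ 2) a (pairMap φ z) =
        Real.exp (-a * sumHeight φ y₀ (pairMap φ z)) := Set.indicator_of_mem hz _
    rw [expBump_mul_expBump hφ hc y₀ hr a hz.2, h]
    ring
  · rw [expCap, Set.indicator_of_notMem hz]
    simp

/-- For large `a` the mass of the tensor square of `expBump` away from the cap is negligible. -/
theorem exists_lintegral_expBump_le (hφ : ContDiff ℝ 2 φ) (hc : ConvexOn ℝ Set.univ φ)
    (y₀ : Plane) {r η : ℝ} (hr : 0 < r) (hη : 0 < η) :
    ∃ a : ℝ, 0 ≤ a ∧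
      0 < ∫⁻ z : Plane × Plane, ENNReal.ofReal (expCap φ y₀ ((r / 2) ^ 2) a (pairMap φ z) ^ 2) ∧
      ∫⁻ z : Plane × Plane, ENNReal.ofReal (expCap φ y₀ ((r / 2) ^ 2) a (pairMap φ z) ^ 2) ≠ ⊤ ∧
      ∫⁻ z : Plane × Plane, ENNReal.ofReal ((expBump φ y₀ r a z.1 * expBump φ y₀ r a z.2) ^ 2) ≤
        ENNReal.ofReal (1 + η) *
          ∫⁻ z : Plane × Plane, ENNReal.ofReal (expCap φ y₀ ((r / 2) ^ 2) a (pairMap φ z) ^ 2) := by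
  set s := (r / 2) ^ 2 with hs
  have hspos : 0 < s := by positivity
  have hΦ := continuous_pairMap hφ.continuous
  have hh : Continuous fun z : Plane × Plane => sumHeight φ y₀ (pairMap φ z) :=
    (continuous_sumHeight y₀).comp hΦ
  set U : Set (Plane × Plane) := {z | sumHeight φ y₀ (pairMap φ z) < s / 2} with hU
  have hUo : IsOpen U := isOpen_lt hh continuous_const
  have hUne : (y₀, y₀) ∈ U := by
    simp only [hU, Set.mem_ofPred_eq, sumHeight_pairMap, tangentHeight]
    simpa using hspos
  set B : Set (Plane × Plane) := Metric.closedBall y₀ r ×ˢ Metric.closedBall y₀ r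
  have hBm : MeasurableSet B := measurableSet_closedBall.prod measurableSet_closedBall
  have hBfin : volume B < ⊤ :=
    ((isCompact_closedBall y₀ r).prod (isCompact_closedBall y₀ r)).measure_lt_top
  have hUB : U ⊆ B := fun z hz => by
    have hd := dist_le_of_sumHeight_le (r := r / 2) hφ hc (by positivity)
      (show sumHeight φ y₀ (pairMap φ z) ≤ (r / 2) ^ 2 by
        have hz' : sumHeight φ y₀ (pairMap φ z) < s / 2 := hz
        linarith)
    exact ⟨Metric.mem_closedBall.2 (by linarith [hd.1]), Metric.mem_closedBall.2
      (by linarith [hd.2])⟩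
  have hUpos : 0 < (volume U).toReal := ENNReal.toReal_pos
    (hUo.measure_pos volume ⟨_, hUne⟩).ne' ((measure_mono hUB).trans_lt hBfin).ne
  have hVol : volume B = ENNReal.ofReal (volume B).toReal := (ENNReal.ofReal_toReal hBfin.ne).symm
  have hVolU : volume U = ENNReal.ofReal (volume U).toReal :=
    (ENNReal.ofReal_toReal ((measure_mono hUB).trans_lt hBfin).ne).symm
  -- On `U` the square of `expCap` is at least `exp (-a s)`. Off the cap, the squared tensor product
  -- is at most `exp (-2 a s)` on `B` and zero elsewhere. Large `a` makes the second contribution at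
  -- most `η` times the first.
  obtain ⟨a, ha0, ha⟩ : ∃ a : ℝ, 0 ≤ a ∧
      Real.exp (-(a * s)) * (volume B).toReal ≤ η * (volume U).toReal := by
    have ht : Tendsto (fun a : ℝ => Real.exp (-(a * s)) * (volume B).toReal) atTop (𝓝 0) := by
      have := (Real.tendsto_exp_neg_atTop_nhds_zero.comp
        (tendsto_id.atTop_mul_const hspos)).mul_const (volume B).toReal
      simpa using this
    obtain ⟨a, h1, h2⟩ := ((eventually_ge_atTop (0 : ℝ)).and
      (ht.eventually_lt_const (mul_pos hη hUpos))).exists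
    exact ⟨a, h1, h2.le⟩
  have hE0 : ∀ y, 0 ≤ expBump φ y₀ r a y := expBump_nonneg y₀ r a
  have hE1 : ∀ z : Plane × Plane, expBump φ y₀ r a z.1 * expBump φ y₀ r a z.2 ≤
      B.indicator 1 z := fun z => by
    by_cases hz : z ∈ B
    · rw [Set.indicator_of_mem hz]
      have h1 := expBump_le_indicator hφ hc y₀ ha0 (r := r) z.1
      have h2 := expBump_le_indicator hφ hc y₀ ha0 (r := r) z.2
      rw [Set.indicator_of_mem hz.1] at h1
      rw [Set.indicator_of_mem hz.2] at h2
      exact mul_le_one₀ h1 (hE0 _) h2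
    · rw [Set.indicator_of_notMem hz]
      rcases not_and_or.1 hz with h | h
      · rw [expBump, Set.indicator_of_notMem h, zero_mul]
      · rw [expBump, Set.indicator_of_notMem (a := z.2) h, mul_zero]
  have hcapU : ∀ z ∈ U, Real.exp (-(a * s)) ≤ expCap φ y₀ s a (pairMap φ z) ^ 2 := fun z hz => by
    have hz' : sumHeight φ y₀ (pairMap φ z) < s / 2 := hz
    rw [expCap, Set.indicator_of_mem
      ((pairMap_mem_sumCap_iff hc y₀ s z).2 (by linarith)), ← Real.exp_nat_mul]
    refine Real.exp_le_exp.2 ?_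
    push_cast
    nlinarith
  have hlow : ENNReal.ofReal (Real.exp (-(a * s)) * (volume U).toReal) ≤
      ∫⁻ z : Plane × Plane, ENNReal.ofReal (expCap φ y₀ s a (pairMap φ z) ^ 2) := by
    rw [ENNReal.ofReal_mul (Real.exp_pos _).le, ← hVolU, ← setLIntegral_const]
    exact (setLIntegral_mono' hUo.measurableSet fun z hz =>
      ENNReal.ofReal_le_ofReal (hcapU z hz)).trans (setLIntegral_le_lintegral _ _)
  have hcapE : ∀ z : Plane × Plane, pairMap φ z ∈ sumCap φ y₀ s →
      expBump φ y₀ r a z.1 * expBump φ y₀ r a z.2 = expCap φ y₀ s a (pairMap φ z) := fun z hz => by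
    rw [expBump_mul_expBump hφ hc y₀ hr a hz.2, expCap, Set.indicator_of_mem hz]
  have hcapE' : ∀ z : Plane × Plane, pairMap φ z ∉ sumCap φ y₀ s →
      (expBump φ y₀ r a z.1 * expBump φ y₀ r a z.2) ^ 2 ≤
        B.indicator (fun _ => Real.exp (-(a * s)) * Real.exp (-(a * s))) z := fun z hz => by
    by_cases hzB : z ∈ B
    · rw [Set.indicator_of_mem hzB, expBump, Set.indicator_of_mem hzB.1,
        Set.indicator_of_mem hzB.2, ← Real.exp_add, ← Real.exp_add, ← Real.exp_nat_mul]
      refine Real.exp_le_exp.2 ?_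
      have h1 : s < sumHeight φ y₀ (pairMap φ z) :=
        not_le.1 fun h => hz ((pairMap_mem_sumCap_iff hc y₀ s z).2 h)
      rw [sumHeight_pairMap] at h1
      push_cast
      nlinarith
    · have h1 := hE1 z
      rw [Set.indicator_of_notMem hzB] at h1 ⊢
      rw [le_antisymm h1 (mul_nonneg (hE0 _) (hE0 _))]
      simp
  refine ⟨a, ha0, ?_, ?_, ?_⟩
  · exact (ENNReal.ofReal_pos.2 (by positivity)).trans_le hlow
  · have hle : ∀ z : Plane × Plane, ENNReal.ofReal (expCap φ y₀ s a (pairMap φ z) ^ 2) ≤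
        B.indicator 1 z := fun z => by
      by_cases hz : pairMap φ z ∈ sumCap φ y₀ s
      · rw [← hcapE z hz]
        have h1 := hE1 z
        have h0 := mul_nonneg (hE0 z.1) (hE0 z.2)
        by_cases hzB : z ∈ B
        · rw [Set.indicator_of_mem hzB] at h1 ⊢
          rw [Pi.one_apply, ENNReal.ofReal_le_one]
          exact pow_le_one₀ h0 h1
        · rw [Set.indicator_of_notMem hzB] at h1 ⊢
          rw [le_antisymm h1 h0]
          simp
      · rw [expCap, Set.indicator_of_notMem hz]
        simp
    refine ((lintegral_mono hle).trans_lt ?_).ne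
    rwa [lintegral_indicator_one hBm]
  · have hmB : Measurable fun z : Plane × Plane => B.indicator
        (fun _ => ENNReal.ofReal (Real.exp (-(a * s)) * Real.exp (-(a * s)))) z :=
      measurable_const.indicator hBm
    calc _ ≤ ∫⁻ z : Plane × Plane, (ENNReal.ofReal (expCap φ y₀ s a (pairMap φ z) ^ 2) +
          B.indicator (fun _ => ENNReal.ofReal (Real.exp (-(a * s)) * Real.exp (-(a * s)))) z) := by
          refine lintegral_mono fun z => ?_
          by_cases hz : pairMap φ z ∈ sumCap φ y₀ s
          · rw [hcapE z hz]
            exact le_self_add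
          · refine (ENNReal.ofReal_le_ofReal (hcapE' z hz)).trans (le_add_left (le_of_eq ?_))
            by_cases hzB : z ∈ B <;> simp [hzB]
      _ = (∫⁻ z : Plane × Plane, ENNReal.ofReal (expCap φ y₀ s a (pairMap φ z) ^ 2)) +
          ENNReal.ofReal (Real.exp (-(a * s)) * Real.exp (-(a * s)) * (volume B).toReal) := by
          rw [lintegral_add_right _ hmB, lintegral_indicator_const hBm,
            ENNReal.ofReal_mul (by positivity) (q := (volume B).toReal), ← hVol]
      _ ≤ (∫⁻ z : Plane × Plane, ENNReal.ofReal (expCap φ y₀ s a (pairMap φ z) ^ 2)) +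
          ENNReal.ofReal η * ENNReal.ofReal (Real.exp (-(a * s)) * (volume U).toReal) := by
          rw [← ENNReal.ofReal_mul hη.le]
          refine add_le_add le_rfl (ENNReal.ofReal_le_ofReal ?_)
          nlinarith [mul_le_mul_of_nonneg_left ha (Real.exp_pos (-(a * s))).le]
      _ ≤ _ := by
          rw [ENNReal.ofReal_add zero_le_one hη.le, ENNReal.ofReal_one, add_mul, one_mul]
          gcongr

end Extremizers

/-! ### Lower bound for the optimal constant -/

section OptimalConstant

variable {φ : Plane → ℝ}

/-- Functions concentrating near a point with small Hessian almost saturate the constant. -/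
theorem exists_le_convNorm_sq (hφ : ContDiff ℝ 2 φ) (hc : ConvexOn ℝ Set.univ φ)
    (hφ0 : ∀ y, 0 ≤ φ y) {y : ℕ → Plane}
    (hy : Tendsto (fun n => hessian φ (y n)) atTop (𝓝 0)) {κ : ℝ} (hκ0 : 0 < κ)
    (hκ : κ < Real.pi / 2) :
    ∃ f : Lp ℂ 2 (volume : Measure Plane), f ≠ 0 ∧
      ENNReal.ofReal κ * (∫⁻ y, ‖f y‖ₑ ^ 2) ^ 2 ≤ convNorm φ f ^ 2 := by
  obtain ⟨c, hc0, hcκ⟩ : ∃ c : ℝ, 0 < c ∧ κ < 2 * Real.pi * (4 + 2 * c)⁻¹ := by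
    -- The choice places `κ (4 + 2 c)` midway between `4 κ` and `2 π`.
    refine ⟨(Real.pi / 2 - κ) / κ, div_pos (by linarith) hκ0, ?_⟩
    have h : κ * (4 + 2 * ((Real.pi / 2 - κ) / κ)) = Real.pi + 2 * κ := by
      field_simp
      ring
    rw [← div_eq_mul_inv, lt_div_iff₀ (by have := div_pos (sub_pos.2 hκ) hκ0; linarith), h]
    linarith
  set κ₁ := 2 * Real.pi * (4 + 2 * c)⁻¹ with hκ₁
  have hκ₁pos : 0 < κ₁ := hκ0.trans hcκ
  obtain ⟨y₀, r, hr, hball⟩ := exists_ball_hessian_le hφ hy hc0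
  -- Here `1 + η = κ₁ / κ`, so the mass lost off the cap is paid for by the margin between `κ` and
  -- `κ₁`.
  obtain ⟨a, ha, hIpos, hIfin, hle⟩ := exists_lintegral_expBump_le hφ hc y₀ (η := κ₁ / κ - 1) hr
    (sub_pos.2 ((one_lt_div hκ0).2 hcκ))
  rw [add_sub_cancel] at hle
  set s := (r / 2) ^ 2
  set I := ∫⁻ z : Plane × Plane, ENNReal.ofReal (expCap φ y₀ s a (pairMap φ z) ^ 2)
  have hmeas := (continuous_pairMap hφ.continuous).measurable
  have hgm : Measurable fun z => (expCap φ y₀ s a z : ℂ) :=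
    Complex.measurable_ofReal.comp (measurable_expCap hφ.continuous y₀ s a)
  have hen : ∀ x : ℝ, ‖(x : ℂ)‖ₑ ^ 2 = ENNReal.ofReal (x ^ 2) := fun x => by
    rw [← ofReal_norm, ← ENNReal.ofReal_pow (norm_nonneg _), Complex.norm_real,
      Real.norm_eq_abs, sq_abs]
  have hg2 : ENNReal.ofReal κ₁ * ∫⁻ z, ‖(expCap φ y₀ s a z : ℂ)‖ₑ ^ 2 ≤ I := by
    have := mul_lintegral_le_lintegral_pairMap hφ hc hφ0 hr hc0 hball
      (G := fun z => ‖(expCap φ y₀ s a z : ℂ)‖ₑ ^ 2) (by fun_prop) fun z hz => by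
        rw [expCap, Set.indicator_of_notMem hz]
        simp
    simpa only [hen] using this
  have hgL : MemLp (fun z => (expCap φ y₀ s a z : ℂ)) 2 volume := by
    refine ⟨hgm.aestronglyMeasurable, ?_⟩
    have h1 : ∫⁻ z, ‖(expCap φ y₀ s a z : ℂ)‖ₑ ^ 2 < ⊤ := by
      refine lt_top_iff_ne_top.2 fun h => ?_
      rw [h, ENNReal.mul_top (ENNReal.ofReal_pos.2 hκ₁pos).ne'] at hg2
      exact hIfin (top_le_iff.1 hg2)
    rw [← eLpNorm_two_sq] at h1
    exact (ENNReal.pow_lt_top_iff (n := 2)).1 h1 |>.resolve_right two_ne_zero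
  have hfL := memLp_expBump hφ hc y₀ r ha
  have hf2 : (∫⁻ y, ‖(hfL.toLp : Lp ℂ 2 (volume : Measure Plane)) y‖ₑ ^ 2) ^ 2 = ∫⁻ z : Plane × Plane,
      ENNReal.ofReal ((expBump φ y₀ r a z.1 * expBump φ y₀ r a z.2) ^ 2) := by
    have hm := measurable_expBump hφ.continuous y₀ r a
    have h1 : ∫⁻ y, ‖(hfL.toLp : Lp ℂ 2 (volume : Measure Plane)) y‖ₑ ^ 2 = ∫⁻ y, ENNReal.ofReal (expBump φ y₀ r a y ^ 2) := by
      refine lintegral_congr_ae ?_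
      filter_upwards [hfL.coeFn_toLp] with y hy
      rw [hy, hen]
    rw [h1, ← lintegral_tensor (by fun_prop)]
    refine lintegral_congr fun z => ?_
    rw [mul_pow, ENNReal.ofReal_mul (sq_nonneg _)]
  have hI2 : I ≤ (∫⁻ y, ‖(hfL.toLp : Lp ℂ 2 (volume : Measure Plane)) y‖ₑ ^ 2) ^ 2 := by
    rw [hf2]
    refine lintegral_mono fun z => ENNReal.ofReal_le_ofReal ?_
    by_cases hz : pairMap φ z ∈ sumCap φ y₀ s
    · rw [expBump_mul_expBump hφ hc y₀ hr a hz.2, expCap, Set.indicator_of_mem hz]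
    · rw [expCap, Set.indicator_of_notMem hz, zero_pow two_ne_zero]
      positivity
  refine ⟨hfL.toLp, fun h0 => ?_, ?_⟩
  · rw [h0] at hI2
    have h1 : ∫⁻ y, ‖(0 : Lp ℂ 2 (volume : Measure Plane)) y‖ₑ ^ 2 = 0 := by
      rw [← eLpNorm_two_sq, eLpNorm_congr_ae (Lp.coeFn_zero ..)]
      simp
    rw [h1] at hI2
    exact hIpos.not_ge (by simpa using hI2)
  obtain ⟨F, hF, hFd, hpair⟩ := exists_isConvDensity hφ hc hfL.toLp
  rw [hFd.convNorm_eq, eLpNorm_two_sq, hf2]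
  have hpairI : ∫ z, (expCap φ y₀ s a z : ℂ) * F z = (I.toReal : ℂ) := by
    have hIr : ∫ z : Plane × Plane, expCap φ y₀ s a (pairMap φ z) ^ 2 = I.toReal :=
      integral_eq_lintegral_of_nonneg_ae (ae_of_all _ fun z => sq_nonneg _)
        (((measurable_expCap hφ.continuous y₀ s a).comp hmeas).pow_const 2).aestronglyMeasurable
    rw [hpair _ hgL, ← hIr, ← integral_complex_ofReal]
    refine integral_congr_ae ?_
    have h1 := (Measure.quasiMeasurePreserving_fst (μ := (volume : Measure Plane))
      (ν := (volume : Measure Plane))).ae_eq_comp hfL.coeFn_toLp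
    have h2 := (Measure.quasiMeasurePreserving_snd (μ := (volume : Measure Plane))
      (ν := (volume : Measure Plane))).ae_eq_comp hfL.coeFn_toLp
    filter_upwards [h1, h2] with z hz1 hz2
    simp only [Function.comp_apply] at hz1 hz2
    rw [hz1, hz2, ← expCap_mul_expBump hφ hc y₀ hr a z]
    push_cast
    rfl
  -- Pairing with `expCap` gives `2 I ≤ κ₁⁻¹ ‖F‖² + κ₁ ‖expCap‖²`. The last term is at most `I` by
  -- the density lower bound, and one finite `I` cancels.
  have hdual := enorm_integral_mul_le (ν := volume) (f := fun z => F z)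
    (g := fun z => (expCap φ y₀ s a z : ℂ)) hF.1 (k := fun _ => κ₁) (fun _ => hκ₁pos)
    measurable_const
  simp only [mul_comm (F _)] at hdual
  rw [hpairI, ← ofReal_norm, Complex.norm_real, Real.norm_of_nonneg ENNReal.toReal_nonneg,
    ENNReal.ofReal_toReal hIfin, lintegral_const_mul' _ _ ENNReal.ofReal_ne_top,
    lintegral_const_mul' _ _ ENNReal.ofReal_ne_top, two_mul] at hdual
  have hN : I ≤ ENNReal.ofReal κ₁⁻¹ * ∫⁻ z, ‖F z‖ₑ ^ 2 :=
    (ENNReal.add_le_add_iff_right hIfin).1 (hdual.trans (add_le_add_right hg2 _))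
  calc _ ≤ ENNReal.ofReal κ * (ENNReal.ofReal (κ₁ / κ) *
        (ENNReal.ofReal κ₁⁻¹ * ∫⁻ z, ‖F z‖ₑ ^ 2)) := by
        gcongr
        exact hle.trans (by gcongr)
    _ = _ := by
        rw [← mul_assoc, ← mul_assoc, ← ENNReal.ofReal_mul hκ0.le,
          ← ENNReal.ofReal_mul (by positivity), show κ * (κ₁ / κ) * κ₁⁻¹ = 1 by field_simp,
          ENNReal.ofReal_one, one_mul]

theorem lintegral_enorm_sq_Lp (f : Lp ℂ 2 (volume : Measure Plane)) :
    ∫⁻ y, ‖f y‖ₑ ^ 2 = ENNReal.ofReal ‖f‖ ^ 2 := by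
  rw [← eLpNorm_two_sq, Lp.norm_def, ENNReal.ofReal_toReal (Lp.eLpNorm_ne_top f)]

/-- The quotient defining `R_φ` contains the square root of the norm, so a bound on the squared norm
is a bound on `R_φ⁴`. Let `κ` increase to `π / 2`. -/
theorem pi_div_two_le_optimalConstant (hφ : ContDiff ℝ 2 φ) (hc : ConvexOn ℝ Set.univ φ)
    (hφ0 : ∀ y, 0 ≤ φ y) {y : ℕ → Plane}
    (hy : Tendsto (fun n => hessian φ (y n)) atTop (𝓝 0)) :
    ENNReal.ofReal (Real.pi / 2) ≤ (optimalConstant φ ^ 2) ^ 2 := by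
  refine le_of_forall_lt fun b hb => ?_
  obtain ⟨κ, hbκ, hκ⟩ := exists_between hb
  have hκfin : κ ≠ ⊤ := hκ.ne_top
  have hκ0 : 0 < κ.toReal := ENNReal.toReal_pos (bot_le.trans_lt hbκ).ne' hκfin
  have hκpi : κ.toReal < Real.pi / 2 := by
    rwa [← ENNReal.lt_ofReal_iff_toReal_lt hκfin]
  refine hbκ.trans_le ?_
  obtain ⟨f, hf, hle⟩ := exists_le_convNorm_sq hφ hc hφ0 hy hκ0 hκpi
  rw [ENNReal.ofReal_toReal hκfin, lintegral_enorm_sq_Lp] at hle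
  have hf0 : ENNReal.ofReal ‖f‖ ≠ 0 := (ENNReal.ofReal_pos.2 (norm_pos_iff.2 hf)).ne'
  have hR : convNorm φ f ^ (1 / 2 : ℝ) / ENNReal.ofReal ‖f‖ ≤ optimalConstant φ :=
    le_iSup₂_of_le (f := fun (f : Lp ℂ 2 (volume : Measure Plane)) (_ : f ≠ 0) =>
      convNorm φ f ^ (1 / 2 : ℝ) / ENNReal.ofReal ‖f‖) f hf le_rfl
  rw [ENNReal.div_le_iff hf0 ENNReal.ofReal_ne_top] at hR
  have h4 : convNorm φ f ^ 2 ≤ (optimalConstant φ ^ 2) ^ 2 * (ENNReal.ofReal ‖f‖ ^ 2) ^ 2 := by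
    have h1 : convNorm φ f = (convNorm φ f ^ (1 / 2 : ℝ)) ^ 2 := by
      rw [← ENNReal.rpow_natCast, ← ENNReal.rpow_mul]
      norm_num
    rw [h1, ← mul_pow, ← mul_pow]
    gcongr
  exact (ENNReal.mul_le_mul_iff_left (pow_ne_zero 2 (pow_ne_zero 2 hf0))
    (ENNReal.pow_ne_top (ENNReal.pow_ne_top ENNReal.ofReal_ne_top))).1 (hle.trans h4)

end OptimalConstant

/-! ### Concentration at infinity -/

theorem corollary5p5 (φ : Plane → ℝ)
    (hφ_nonneg : ∀ y, 0 ≤ φ y)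
    (hφ_C2 : ContDiff ℝ 2 φ)
    (hφ_convex : StrictConvexOn ℝ Set.univ φ)
    (hess_ne_zero : ∀ y, hessian φ y ≠ 0)
    (hess_tendsto : ∃ y : ℕ → Plane, Tendsto (fun n => ‖y n‖) atTop atTop ∧
      Tendsto (fun n => hessian φ (y n)) atTop (𝓝 0))
    (f : ℕ → Lp ℂ 2 (volume : Measure Plane))
    (hf : IsExtremizingSeq φ f) :
    ConcentratesAtInfinity f := by
  obtain ⟨y, -, hy⟩ := hess_tendsto
  have hc := hφ_convex.convexOn
  intro ε hε ρ _
  obtain ⟨δ, hδ, hle⟩ := exists_convNorm_sq_add_le hφ_C2 hc hφ_nonneg hess_ne_zero ρ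
  have hR := pi_div_two_le_optimalConstant hφ_C2 hc hφ_nonneg hy
  have hlim : Tendsto (fun n => convNorm φ (f n) ^ 2) atTop (𝓝 ((optimalConstant φ ^ 2) ^ 2)) :=
    (ENNReal.continuous_pow 2).continuousAt.tendsto.comp hf.2
  -- Mass above `ε ‖f n‖²` in the ball would force the squared norm below this threshold, which the
  -- limit strictly exceeds.
  have hlt : ENNReal.ofReal (Real.pi / 2 - δ * ε ^ 2) < (optimalConstant φ ^ 2) ^ 2 := by
    refine lt_of_lt_of_le ?_ hR
    rw [ENNReal.ofReal_lt_ofReal_iff (by positivity)]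
    have := mul_pos hδ (pow_pos hε 2)
    linarith
  obtain ⟨N, hN⟩ := eventually_atTop.1 (hlim.eventually (lt_mem_nhds hlt))
  refine ⟨N, fun n hn => ?_⟩
  by_contra! hcon
  refine absurd (hN n hn) (not_lt.2 ?_)
  have hfn := hf.1 n
  have hB : MeasurableSet {y : Plane | ‖y‖ ≤ ρ} := measurableSet_le (by fun_prop) (by fun_prop)
  set m := ∫ y in {y : Plane | ‖y‖ ≤ ρ}, ‖f n y‖ ^ 2
  have hint : Integrable (fun y => ‖f n y‖ ^ 2) volume :=
    (Lp.memLp (f n)).integrable_norm_pow (by norm_num)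
  have hm : ∫⁻ y in {y : Plane | ‖y‖ ≤ ρ}, ‖f n y‖ₑ ^ 2 = ENNReal.ofReal m := by
    rw [ofReal_integral_eq_lintegral_ofReal hint.integrableOn
      (ae_of_all _ fun y => by positivity)]
    refine lintegral_congr fun y => ?_
    rw [ENNReal.ofReal_pow (norm_nonneg _), ofReal_norm]
  have h1 := hle (f n)
  have hm0 : 0 ≤ m := (by positivity : 0 ≤ ε * ‖f n‖ ^ 2).trans hcon.le
  rw [lintegral_enorm_sq_Lp, hm, ← ENNReal.ofReal_pow hm0, ← ENNReal.ofReal_mul hδ.le,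
    ← ENNReal.ofReal_pow (norm_nonneg _), ← ENNReal.ofReal_pow (by positivity),
    ← ENNReal.ofReal_mul (by positivity)] at h1
  have hfin : convNorm φ (f n) ^ 2 ≠ ⊤ :=
    ne_top_of_le_ne_top ENNReal.ofReal_ne_top (le_self_add.trans h1)
  rw [← ENNReal.ofReal_toReal hfin] at h1 ⊢
  set X := (convNorm φ (f n) ^ 2).toReal
  have hX0 : 0 ≤ X := ENNReal.toReal_nonneg
  rw [← ENNReal.ofReal_add hX0 (by positivity),
    ENNReal.ofReal_le_ofReal_iff (by positivity)] at h1
  refine ENNReal.ofReal_le_ofReal ?_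
  have hm2 : (ε * ‖f n‖ ^ 2) ^ 2 < m ^ 2 := pow_lt_pow_left₀ hcon (by positivity) two_ne_zero
  have h2 : X < (Real.pi / 2 - δ * ε ^ 2) * (‖f n‖ ^ 2) ^ 2 := by
    nlinarith [mul_lt_mul_of_pos_left hm2 hδ]
  have hn1 : (‖f n‖ ^ 2) ^ 2 ≤ 1 := pow_le_one₀ (by positivity) (pow_le_one₀ (norm_nonneg _) hfn)
  -- For a nonnegative threshold, `‖f n‖ ≤ 1` finishes; a negative one would make the squared norm
  -- `X` negative.
  rcases le_or_gt 0 (Real.pi / 2 - δ * ε ^ 2) with hs | hs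
  · exact h2.le.trans (mul_le_of_le_one_right hs hn1)
  · exact absurd (h2.trans_le (mul_nonpos_of_nonpos_of_nonneg hs.le (by positivity))) hX0.not_gt
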